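/- Let $\mathbf T=\bigcup_{n\ge 0}\mathbb N^n$ be the tree with root $\emptyset$ in which every vertex $u$ has daughters $u1,u2,\dots$, and let $(N_u)_{u\in\mathbf T}$ be i.i.d. random variables with values in $\{0,1,2,\dots\}\cup\{\infty\}$, with common law $d$ and generating function $H(s)=\sum_{0\le n<\infty}\mathbb P(N_\emptyset=n)\,s^n$, $s\in[0,1]$. Assume that $H(0)=0$ (so $N_u\ge 1$ a.s.) and that $H$ is strictly convex on $[0,1]$. A family $X=(X_u)_{u\in\mathbf T}$ of $[0,1]$-valued random variables, on the probability space carrying $(N_u)$, is a *tree-indexed solution* if (i) for every $n$ the variables $(X_u;|u|=n)$ are mutually independent and, jointly, independent of $(N_v;|v|\le n-1)$; (ii) $X_u=1-\prod_{i=1}^{N_u}X_{ui}$ a.s. for every $u$; and (iii) all $X_u$ have the same distribution. It is *endogenous* if every $X_u$ is, up to modification on a null set, measurable with respect to $\sigma(N_v;v\in\mathbf T)$. A probability measure $\nu$ on $[0,1]$ is an *invariant distribution* if $1-\prod_{i=1}^{N}X_i$ has law $\nu$ whenever $X_1,X_2,\dots$ are i.i.d. with law $\nu$ and $N$ is independent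 of them with law $d$. Let $S=(S_u)_{u\in\mathbf T}$ be a discrete solution, that is, a tree-indexed solution with values in $\{0,1\}$; let $C_u=\mathbb P(S_u=1\mid N_v;v\in\mathbf T)$ and $\mu^1=\mathbb E[S_\emptyset]$. Then: 1. $S$ is endogenous if and only if $H'(\mu^1)\le 1$. 2. $C=(C_u)_{u\in\mathbf T}$ is an endogenous tree-indexed solution, and it is the only one: every endogenous tree-indexed solution $L$ satisfies $L_u=C_u$ a.s. for all $u\in\mathbf T$. 3. The laws of $S_\emptyset$ and $C_\emptyset$ are invariant distributions, and they are the only invariant distributions on $[0,1]$. -/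

import Mathlib

open MeasureTheory ProbabilityTheory Set
open scoped ENNReal

/-- Vertices of the tree `⋃ₙ ℕⁿ` with countably infinite branching, as finite address sequences.
The root is `[]`, the depth of `u` is `u.length`, and the daughters of `u` are `u ++ [i]`, `i : ℕ`
(daughters are numbered from `0`, so `u ++ [i]` is the `(i+1)`-st daughter of `u`). -/
abbrev Vertex : Type := List ℕ

/-- The product of the first `N` terms of a sequence, where `N` is a natural number or `∞`.
For sequences in `[0,1]` the product always converges, see `multipliable_firstProd`. -/
noncomputable def firstProd (N : ℕ∞) (x : ℕ → ℝ) : ℝ :=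
  ∏' i : ℕ, if (i : ℕ∞) < N then x i else 1

theorem multipliable_firstProd (N : ℕ∞) (x : ℕ → ℝ) (hx : ∀ i, x i ∈ Icc (0 : ℝ) 1) :
    Multipliable (fun i : ℕ => if (i : ℕ∞) < N then x i else 1) := by
  have h0 : ∀ i : ℕ, 0 ≤ (if (i : ℕ∞) < N then x i else 1) := by
    intro i; split_ifs
    · exact (hx i).1
    · exact zero_le_one
  have h1 : ∀ i : ℕ, (if (i : ℕ∞) < N then x i else 1) ≤ 1 := by
    intro i; split_ifs
    · exact (hx i).2
    · exact le_rfl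
  have hanti : Antitone
      (fun s : Finset ℕ => ∏ i ∈ s, (if (i : ℕ∞) < N then x i else 1)) := by
    intro s t hst
    simp only
    rw [← Finset.prod_sdiff hst]
    exact mul_le_of_le_one_left (Finset.prod_nonneg fun i _ => h0 i)
      (Finset.prod_le_one (fun i _ => h0 i) fun i _ => h1 i)
  refine ⟨_, tendsto_atTop_ciInf hanti ⟨0, ?_⟩⟩
  rintro _ ⟨s, rfl⟩
  exact Finset.prod_nonneg fun i _ => h0 i

/-- The probability generating function `H(s) = E[s^N; N < ∞] = ∑ₙ P(N = n) sⁿ` of a law `d` on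
`{0, 1, 2, …, ∞}`. -/
noncomputable def pgf (d : Measure ℕ∞) (s : ℝ) : ℝ :=
  ∑' n : ℕ, d.real {(n : ℕ∞)} * s ^ n

/-- The map on laws: `ν` is sent to the law of `1 - ∏_{i ≤ N} Xᵢ`, where `N` has law `d`, the `Xᵢ`
are independent with law `ν`, and `N` is independent of `(Xᵢ)`. -/
noncomputable def rdeMap (d : Measure ℕ∞) (ν : Measure ℝ) [IsProbabilityMeasure ν] : Measure ℝ :=
  (d.prod (Measure.infinitePi fun _ : ℕ => ν)).map
    (fun p : ℕ∞ × (ℕ → ℝ) => 1 - firstProd p.1 p.2)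

/-- `ν` is an invariant distribution on `[0,1]` of the recursive distributional equation
`X = 1 - ∏_{i ≤ N} Xᵢ`, where `N` has law `d`. -/
def IsInvariantLaw (d : Measure ℕ∞) (ν : Measure ℝ) : Prop :=
  ∃ _ : IsProbabilityMeasure ν, (∀ᵐ x ∂ν, x ∈ Icc (0 : ℝ) 1) ∧ rdeMap d ν = ν

/-- The σ-algebra `σ(N_v ; v ∈ T)` generated by the family sizes. -/
abbrev familySigma {Ω : Type*} (N : Vertex → Ω → ℕ∞) : MeasurableSpace Ω :=
  ⨆ v : Vertex, MeasurableSpace.comap (N v) inferInstance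

/-- `X` is a tree-indexed solution with values in `[0,1]` of
`X_u = 1 - ∏_{i ≤ N_u} X_{ui}`, `u ∈ T`. -/
structure IsTreeSolution {Ω : Type*} [MeasurableSpace Ω] (μ : Measure Ω)
    (N : Vertex → Ω → ℕ∞) (X : Vertex → Ω → ℝ) : Prop where
  measurable : ∀ u, Measurable (X u)
  mem_Icc : ∀ u, ∀ᵐ ω ∂μ, X u ω ∈ Icc (0 : ℝ) 1
  /-- the variables on one level are mutually independent -/
  iIndep_level : ∀ n : ℕ, iIndepFun (fun (u : {u : Vertex // u.length = n}) => X u.1) μ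
  /-- the variables on one level are jointly independent of the family sizes strictly above it -/
  indep_above : ∀ n : ℕ,
    IndepFun (fun ω (u : {u : Vertex // u.length = n}) => X u.1 ω)
      (fun ω (v : {v : Vertex // v.length < n}) => N v.1 ω) μ
  recursion : ∀ u, ∀ᵐ ω ∂μ, X u ω = 1 - firstProd (N u ω) (fun i => X (u ++ [i]) ω)
  stationary : ∀ u v, IdentDistrib (X u) (X v) μ μ

/-- A discrete solution: a tree-indexed solution with values in `{0,1}`. -/
structure IsDiscreteSolution {Ω : Type*} [MeasurableSpace Ω] (μ : Measure Ω)
    (N : Vertex → Ω → ℕ∞) (S : Vertex → Ω → ℝ) : Prop extends IsTreeSolution μ N S where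
  zero_or_one : ∀ u, ∀ᵐ ω ∂μ, S u ω = 0 ∨ S u ω = 1

/-- `X` is endogenous: every `X_u` is measurable with respect to `σ(N_v ; v ∈ T)`, up to null
sets. -/
def IsEndogenous {Ω : Type*} [MeasurableSpace Ω] (μ : Measure Ω)
    (N : Vertex → Ω → ℕ∞) (X : Vertex → Ω → ℝ) : Prop :=
  ∀ u, ∃ Y : Ω → ℝ, Measurable[familySigma N] Y ∧ X u =ᵐ[μ] Y

/-- The conditional probability process `C_u = P(S_u = 1 | N_v, v ∈ T)`. -/
noncomputable def condProbSolution {Ω : Type*} [MeasurableSpace Ω] (μ : Measure Ω)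
    (N : Vertex → Ω → ℕ∞) (S : Vertex → Ω → ℝ) (u : Vertex) : Ω → ℝ :=
  μ⟦{ω | S u ω = 1} | familySigma N⟧

/-! Write H = `pgf d`, let m be the mean of S at the root, and put Q(x) = 2m − 1 + H(x).

First moments. Taking expectations in the recursion, the mean of any invariant law lies in [0,1) and
solves H(m) = 1 − m. Since H is nondecreasing, this root is unique, so all invariant laws share the
mean m (`mean_of_invariant`, `root_unique`).

Second moments. Expanding (1 − ∏f)(1 − ∏g) over independent branches sends a mixed moment x = E[fg]
of two functionals of mean m to Q(x) (`integral_branch_mul`). Hence the second moment of an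
invariant law is a fixed point of Q in [0, m], and m itself is one.

The process C. Run the recursion upwards from depth k below u with the constant boundary value m.
For any tree solution X this is the conditional mean of X_u given the family sizes above that depth
(`IsTreeSolution.condExp_familyFiltration`), so it converges a.s. to E[X_u | N]. The limit depends
on X only through the common mean m: it is C_u, and an endogenous solution must equal it. The
recursion passes to the limit; for an infinite family the limiting product vanishes because its mean
is that of ∏m = 0.

Classification. The approximations have second moments Q^k(m²) (`momentIter`), which tend to r =
E[C²]. For an invariant ν, comparing boundary values drawn from ν with the constant m gives squared
distance ∫t² dν − Q^k(m²) (`integral_treeValue_sub_sq`). So r ≤ ∫t² dν ≤ m, and strict convexity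
leaves only the values r and m. The value m forces ν onto {0,1}; the value r makes the distance
vanish in the limit, so ν is the law of C.

Endogeny amounts to r = m. If H'(m) ≤ 1, strict convexity excludes a fixed point of Q below m. If
H'(m) > 1, Q lies below the diagonal just left of m, and a point there blocks the iterates of m²
from reaching m. -/

open Filter Topology

/-! ### Products of random, possibly infinite, length -/

section FirstProd

variable {N : ℕ∞} {x y : ℕ → ℝ}

theorem tendsto_firstProd (hx : ∀ i, x i ∈ Icc (0 : ℝ) 1) :
    Tendsto (fun K => ∏ i ∈ Finset.range K, if (i : ℕ∞) < N then x i else 1) atTop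
      (𝓝 (firstProd N x)) :=
  (multipliable_firstProd N x hx).hasProd.tendsto_prod_nat

theorem ite_mem_Icc (hx : ∀ i, x i ∈ Icc (0 : ℝ) 1) (i : ℕ) :
    (if (i : ℕ∞) < N then x i else 1) ∈ Icc (0 : ℝ) 1 := by
  split_ifs
  · exact hx i
  · simp

theorem prod_mem_Icc (hx : ∀ i, x i ∈ Icc (0 : ℝ) 1) (s : Finset ℕ) :
    (∏ i ∈ s, x i) ∈ Icc (0 : ℝ) 1 :=
  ⟨Finset.prod_nonneg fun i _ => (hx i).1,
    Finset.prod_le_one (fun i _ => (hx i).1) fun i _ => (hx i).2⟩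

theorem firstProd_mem_Icc (hx : ∀ i, x i ∈ Icc (0 : ℝ) 1) : firstProd N x ∈ Icc (0 : ℝ) 1 :=
  isClosed_Icc.mem_of_tendsto (tendsto_firstProd hx)
    (Eventually.of_forall fun _ => prod_mem_Icc (ite_mem_Icc hx) _)

theorem one_sub_firstProd_mem_Icc (hx : ∀ i, x i ∈ Icc (0 : ℝ) 1) :
    1 - firstProd N x ∈ Icc (0 : ℝ) 1 := by
  have := firstProd_mem_Icc (N := N) hx
  exact ⟨by linarith [this.2], by linarith [this.1]⟩

theorem firstProd_natCast (n : ℕ) (x : ℕ → ℝ) :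
    firstProd n x = ∏ i ∈ Finset.range n, x i := by
  unfold firstProd
  rw [tprod_eq_prod (s := Finset.range n)]
  · refine Finset.prod_congr rfl fun i hi => ?_
    simp [Finset.mem_range.1 hi]
  · intro i hi
    have hi' : n ≤ i := by simpa using hi
    exact if_neg (by simpa using hi')

theorem tendsto_firstProd_top (hx : ∀ i, x i ∈ Icc (0 : ℝ) 1) :
    Tendsto (fun K => ∏ i ∈ Finset.range K, x i) atTop (𝓝 (firstProd ⊤ x)) := by
  simpa using tendsto_firstProd (N := ⊤) hx

theorem firstProd_top_le (hx : ∀ i, x i ∈ Icc (0 : ℝ) 1) (K : ℕ) :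
    firstProd ⊤ x ≤ ∏ i ∈ Finset.range K, x i := by
  refine Antitone.le_of_tendsto (antitone_nat_of_succ_le fun n => ?_) (tendsto_firstProd_top hx) K
  rw [Finset.prod_range_succ]
  exact mul_le_of_le_one_right (prod_mem_Icc hx _).1 (hx n).2

theorem firstProd_top_const {s : ℝ} (h0 : 0 ≤ s) (h1 : s < 1) : firstProd ⊤ (fun _ => s) = 0 := by
  refine tendsto_nhds_unique (tendsto_firstProd_top fun _ => ⟨h0, h1.le⟩) ?_
  simpa using tendsto_pow_atTop_nhds_zero_of_lt_one h0 h1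

theorem firstProd_one (N : ℕ∞) : firstProd N (fun _ => 1) = 1 := by
  simp [firstProd]

theorem firstProd_mul (hx : ∀ i, x i ∈ Icc (0 : ℝ) 1) (hy : ∀ i, y i ∈ Icc (0 : ℝ) 1) :
    firstProd N x * firstProd N y = firstProd N (fun i => x i * y i) := by
  have hxy : ∀ i, x i * y i ∈ Icc (0 : ℝ) 1 := fun i =>
    ⟨mul_nonneg (hx i).1 (hy i).1, mul_le_one₀ (hx i).2 (hy i).1 (hy i).2⟩
  refine tendsto_nhds_unique ((tendsto_firstProd hx).mul (tendsto_firstProd hy)) ?_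
  refine (tendsto_firstProd hxy).congr fun K => ?_
  rw [← Finset.prod_mul_distrib]
  refine Finset.prod_congr rfl fun i _ => ?_
  split_ifs <;> simp

/-- The product is continuous along sequences at points where it is finite or zero. -/
theorem tendsto_firstProd_of_tendsto {X : ℕ → ℕ → ℝ} (hX : ∀ n i, X n i ∈ Icc (0 : ℝ) 1)
    (hlim : ∀ i, Tendsto (fun n => X n i) atTop (𝓝 (x i))) (hN : N = ⊤ → firstProd ⊤ x = 0) :
    Tendsto (fun n => firstProd N (X n)) atTop (𝓝 (firstProd N x)) := by
  have hx : ∀ i, x i ∈ Icc (0 : ℝ) 1 := fun i =>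
    isClosed_Icc.mem_of_tendsto (hlim i) (Eventually.of_forall fun n => hX n i)
  induction N using ENat.recTopCoe with
  | coe n =>
    simp only [firstProd_natCast]
    exact tendsto_finsetProd _ fun i _ => hlim i
  | top =>
    rw [hN rfl]
    -- Infinite products are not continuous in general. At the limit 0 only an upper bound is
    -- needed, and a single partial product with value below a supplies it.
    refine tendsto_order.2 ⟨fun a ha => Eventually.of_forall fun n =>
      ha.trans_le (firstProd_mem_Icc (hX n)).1, fun a ha => ?_⟩
    have h1 := tendsto_firstProd_top hx
    rw [hN rfl] at h1
    obtain ⟨K, hK⟩ := (h1.eventually (gt_mem_nhds ha)).exists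
    filter_upwards [(tendsto_finsetProd (Finset.range K) fun i _ => hlim i).eventually
      (gt_mem_nhds hK)] with n hn
    exact (firstProd_top_le (hX n) K).trans_lt hn

theorem measurable_firstProd {α : Type*} [MeasurableSpace α] {n : α → ℕ∞} {f : ℕ → α → ℝ}
    (hn : Measurable n) (hf : ∀ i, Measurable (f i)) (hf01 : ∀ i a, f i a ∈ Icc (0 : ℝ) 1) :
    Measurable (fun a => firstProd (n a) (fun i => f i a)) := by
  refine measurable_of_tendsto_metrizable (f := fun K a => ∏ i ∈ Finset.range K,
    if (i : ℕ∞) < n a then f i a else 1) (fun K => ?_)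
    (tendsto_pi_nhds.2 fun a => tendsto_firstProd fun i => hf01 i a)
  refine Finset.measurable_prod _ fun i _ => ?_
  exact Measurable.ite (hn (MeasurableSet.of_discrete (s := Ioi (i : ℕ∞)))) (hf i) measurable_const

/-- The expectation of a product of independent `[0,1]`-valued variables. -/
theorem integral_firstProd {Ω : Type*} [MeasurableSpace Ω] {μ : Measure Ω}
    {f : ℕ → Ω → ℝ} (hf : ∀ i, Measurable (f i)) (hf01 : ∀ i a, f i a ∈ Icc (0 : ℝ) 1)
    (hind : iIndepFun f μ) (N : ℕ∞) :
    ∫ ω, firstProd N (fun i => f i ω) ∂μ = firstProd N (fun i => ∫ ω, f i ω ∂μ) := by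
  have := hind.isProbabilityMeasure
  have hint : ∀ i, (∫ ω, f i ω ∂μ) ∈ Icc (0 : ℝ) 1 := fun i => by
    refine ⟨integral_nonneg fun ω => (hf01 i ω).1, ?_⟩
    have := integral_mono_of_nonneg (μ := μ) (f := f i) (g := fun _ => 1)
      (ae_of_all _ fun ω => (hf01 i ω).1) (integrable_const _) (ae_of_all _ fun ω => (hf01 i ω).2)
    simpa using this
  -- Both sides are limits of the truncated products: the left by dominated convergence, the right
  -- because finite independent products factor.
  refine tendsto_nhds_unique (f := fun K => ∫ ω, ∏ i ∈ Finset.range K,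
    (if (i : ℕ∞) < N then f i ω else 1) ∂μ) (l := atTop) ?_ ?_
  · refine tendsto_integral_of_dominated_convergence (fun _ => (1 : ℝ)) (fun K => ?_)
      (integrable_const _) (fun K => ae_of_all _ fun ω => ?_)
      (ae_of_all _ fun ω => tendsto_firstProd fun i => hf01 i ω)
    · refine (Finset.measurable_prod _ fun i _ => ?_).aestronglyMeasurable
      split_ifs
      · exact hf i
      · exact measurable_const
    · have := prod_mem_Icc (ite_mem_Icc (N := N) fun i => hf01 i ω) (Finset.range K)
      rw [Real.norm_of_nonneg this.1]
      exact this.2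
  · refine (tendsto_firstProd (N := N) hint).congr fun K => ?_
    have hind' : iIndepFun (fun i ω => if ((i : ℕ) : ℕ∞) < N then f i ω else 1) μ := by
      refine (hind.comp (fun (i : ℕ) t => if (i : ℕ∞) < N then t else 1) fun i => ?_)
      split_ifs
      · exact measurable_id
      · exact measurable_const
    have hm : ∀ i : ℕ, Measurable (fun ω => if (i : ℕ∞) < N then f i ω else 1) := by
      intro i
      split_ifs
      · exact hf i
      · exact measurable_const
    have h2 := iIndepFun.integral_fun_prod_eq_prod_integral
      (hind'.precomp (Fin.val_injective (n := K))) (fun i => (hm i).aestronglyMeasurable)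
    rw [← Fin.prod_univ_eq_prod_range
      (fun i : ℕ => if (i : ℕ∞) < N then ∫ ω, f i ω ∂μ else 1)]
    simp_rw [← Fin.prod_univ_eq_prod_range
      (fun i : ℕ => if (i : ℕ∞) < N then f i _ else 1)]
    rw [h2]
    refine Finset.prod_congr rfl fun i _ => ?_
    split_ifs <;> simp

end FirstProd

/-- For s < 1 the atom at ∞ contributes 0, in agreement with the sum in `pgf`, which omits it. At s
= 1 the two sides differ when d charges ∞; this is why means must be shown to be below 1. -/
theorem integral_firstProd_const (d : Measure ℕ∞) [IsProbabilityMeasure d] {s : ℝ} (h0 : 0 ≤ s)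
    (h1 : s < 1) : ∫ n, firstProd n (fun _ => s) ∂d = pgf d s := by
  have hint : Integrable (fun n => firstProd n (fun _ => s)) d := by
    refine Integrable.of_bound (C := 1)
      (measurable_from_top (f := fun n => firstProd n (fun _ => s))).aestronglyMeasurable
      (ae_of_all _ fun n => ?_)
    have := firstProd_mem_Icc (N := n) (x := fun _ => s) fun _ => ⟨h0, h1.le⟩
    rw [Real.norm_of_nonneg this.1]
    exact this.2
  rw [integral_countable hint, ← Function.Injective.tsum_eq (g := ((↑) : ℕ → ℕ∞))
    (fun a b h => by simpa using h)]
  · simp [pgf, firstProd_natCast]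
  · intro n hn
    induction n using ENat.recTopCoe with
    | coe n => exact ⟨n, rfl⟩
    | top => simp [firstProd_top_const h0 h1] at hn

/-! ### Independence of blocks and branching at the root -/

theorem comap_pi_eq_iSup {Ω ι : Type*} {α : ι → Type*} [∀ i, MeasurableSpace (α i)]
    (X : ∀ i, Ω → α i) :
    MeasurableSpace.comap (fun ω i => X i ω) MeasurableSpace.pi =
      ⨆ i, MeasurableSpace.comap (X i) inferInstance := by
  simp only [MeasurableSpace.pi, MeasurableSpace.comap_iSup, MeasurableSpace.comap_comp]
  rfl

/-- Disjoint subfamilies of an independent family are independent. -/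
theorem indepFun_of_disjoint_ranges {Ω ι κ κ' : Type*} [MeasurableSpace Ω] {μ : Measure Ω}
    {α : Type*} [MeasurableSpace α] {X : ι → Ω → α} (hX : ∀ i, Measurable (X i))
    (hind : iIndepFun X μ) (a : κ → ι) (b : κ' → ι) (hab : ∀ i j, a i ≠ b j) :
    IndepFun (fun ω i => X (a i) ω) (fun ω j => X (b j) ω) μ := by
  have := hind.isProbabilityMeasure
  have h := indep_iSup_of_disjoint (fun i => (hX i).comap_le) hind
    (S := range a) (T := range b) (by
      rw [Set.disjoint_left]
      rintro _ ⟨i, rfl⟩ ⟨j, hj⟩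
      exact hab i j hj.symm)
  rw [IndepFun_iff_Indep, comap_pi_eq_iSup, comap_pi_eq_iSup]
  refine indep_of_indep_of_le_left (indep_of_indep_of_le_right h ?_) ?_
  · exact iSup_le fun j => le_iSup₂_of_le (b j) ⟨j, rfl⟩ le_rfl
  · exact iSup_le fun j => le_iSup₂_of_le (a j) ⟨j, rfl⟩ le_rfl

/-- Disjoint blocks of an independent family, the blocks being indexed by `κ`, are independent. -/
theorem iIndepFun_blocks {Ω ι κ κ' α : Type*} [MeasurableSpace Ω] {μ : Measure Ω}
    [MeasurableSpace α] {X : ι → Ω → α} (hX : ∀ i, Measurable (X i))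
    (hind : iIndepFun X μ) {e : κ → κ' → ι} (he : Function.Injective fun p : κ × κ' => e p.1 p.2) :
    iIndepFun (fun k ω (k' : κ') => X (e k k') ω) μ := by
  have := hind.isProbabilityMeasure
  have hp : ∀ i, IsProbabilityMeasure (μ.map (X i)) := fun i =>
    Measure.isProbabilityMeasure_map (hX i).aemeasurable
  have h1 := (hind.precomp he).map_fun_eq_infinitePi_map fun p => hX _
  have hrow : ∀ k, μ.map (fun ω (k' : κ') => X (e k k') ω) =
      Measure.infinitePi fun k' => μ.map (X (e k k')) := fun k =>
    (hind.precomp (g := e k) fun a b hab => by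
      have := @he (k, a) (k, b) hab
      simpa using this).map_fun_eq_infinitePi_map fun p => hX _
  rw [iIndepFun_iff_map_fun_eq_infinitePi_map fun k => measurable_pi_lambda _ fun k' => hX _]
  simp_rw [hrow]
  -- Injectivity of e makes the doubly indexed family have a product law; currying it gives the
  -- product of the row laws.
  rw [← Measure.infinitePi_map_curry (fun k k' => μ.map (X (e k k'))), ← h1,
    Measure.map_map (MeasurableEquiv.measurable _) (measurable_pi_lambda _ fun p => hX _)]
  rfl

/-- A uniform labelled tree splits at the root into the root label and independent subtrees. -/
theorem infinitePi_map_branch {E : Type*} [MeasurableSpace E] (ρ : Measure E)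
    [IsProbabilityMeasure ρ] :
    (Measure.infinitePi fun _ : Vertex => ρ).map
        (fun y => (y [], fun (i : ℕ) (v : Vertex) => y (i :: v))) =
      ρ.prod (Measure.infinitePi fun _ : ℕ => Measure.infinitePi fun _ : Vertex => ρ) := by
  have hco : iIndepFun (fun (v : Vertex) (y : Vertex → E) => y v)
      (Measure.infinitePi fun _ : Vertex => ρ) :=
    iIndepFun_infinitePi (X := fun _ x => x) fun _ => measurable_id
  have hbl := iIndepFun_blocks (fun v => measurable_pi_apply v) hco
    (e := fun (i : ℕ) (v : Vertex) => i :: v) (by rintro ⟨a, b⟩ ⟨c, d⟩ h; simpa using h)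
  have hind := indepFun_of_disjoint_ranges (fun v => measurable_pi_apply v) hco
    (fun _ : Unit => ([] : Vertex)) (fun p : ℕ × Vertex => p.1 :: p.2) (by simp)
  have hroot : Measurable (fun x : Unit → E => x ()) := measurable_pi_apply ()
  have hcurry : Measurable (fun (x : ℕ × Vertex → E) (i : ℕ) (v : Vertex) => x (i, v)) := by
    fun_prop
  have hind' := hind.comp hroot hcurry
  have := (indepFun_iff_map_prod_eq_prod_map_map
    (hroot.comp (by fun_prop)).aemeasurable (hcurry.comp (by fun_prop)).aemeasurable).1 hind'
  refine this.trans ?_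
  congr 1
  · exact Measure.infinitePi_map_eval (fun _ : Vertex => ρ) []
  · refine (hbl.map_fun_eq_infinitePi_map (fun i => by fun_prop)).trans ?_
    congr 1
    funext i
    exact Measure.map_infinitePi_infinitePi_of_inj (P := fun _ : Vertex => ρ)
      (f := fun v : Vertex => i :: v) (List.cons_injective)

/-! ### First and second moments across one branching -/

theorem integral_mem_Icc {Ω : Type*} [MeasurableSpace Ω] {μ : Measure Ω} [IsProbabilityMeasure μ]
    {f : Ω → ℝ} (hf01 : ∀ ω, f ω ∈ Icc (0 : ℝ) 1) : (∫ ω, f ω ∂μ) ∈ Icc (0 : ℝ) 1 := by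
  refine ⟨integral_nonneg fun ω => (hf01 ω).1, ?_⟩
  have := integral_mono_of_nonneg (μ := μ) (f := f) (g := fun _ => 1)
    (ae_of_all _ fun ω => (hf01 ω).1) (integrable_const _) (ae_of_all _ fun ω => (hf01 ω).2)
  simpa using this

theorem integrable_of_mem_Icc {Ω : Type*} [MeasurableSpace Ω] {μ : Measure Ω} [IsFiniteMeasure μ]
    {f : Ω → ℝ} (hf : Measurable f) (hf01 : ∀ ω, f ω ∈ Icc (0 : ℝ) 1) : Integrable f μ :=
  Integrable.of_bound hf.aestronglyMeasurable 1 (ae_of_all _ fun ω => by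
    rw [Real.norm_of_nonneg (hf01 ω).1]
    exact (hf01 ω).2)

theorem mul_mem_Icc {a b : ℝ} (ha : a ∈ Icc (0 : ℝ) 1) (hb : b ∈ Icc (0 : ℝ) 1) :
    a * b ∈ Icc (0 : ℝ) 1 :=
  ⟨mul_nonneg ha.1 hb.1, mul_le_one₀ ha.2 hb.1 hb.2⟩

/-- Averaging a product of random length over independent copies of `f`. -/
theorem integral_prod_firstProd {E : Type*} [MeasurableSpace E] (d : Measure ℕ∞)
    [IsProbabilityMeasure d] (ρ : Measure E) [IsProbabilityMeasure ρ] {f : E → ℝ}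
    (hf : Measurable f) (hf01 : ∀ e, f e ∈ Icc (0 : ℝ) 1) :
    ∫ p, firstProd p.1 (fun i => f (p.2 i)) ∂(d.prod (Measure.infinitePi fun _ : ℕ => ρ)) =
      ∫ n, firstProd n (fun _ => ∫ e, f e ∂ρ) ∂d := by
  rw [integral_prod]
  · refine integral_congr_ae (ae_of_all _ fun n => ?_)
    have hind : iIndepFun (fun (i : ℕ) (y : ℕ → E) => f (y i))
        (Measure.infinitePi fun _ : ℕ => ρ) :=
      iIndepFun_infinitePi (X := fun _ x => f x) fun _ => hf
    refine (integral_firstProd (fun i => hf.comp (measurable_pi_apply i)) (fun i y => hf01 _) hind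
      n).trans ?_
    congr 1
    funext i
    rw [← Measure.infinitePi_map_eval (fun _ : ℕ => ρ) i,
      integral_map (measurable_pi_apply i).aemeasurable hf.aestronglyMeasurable,
      Measure.infinitePi_map_eval]
    rfl
  · refine integrable_of_mem_Icc (measurable_firstProd measurable_fst
      (fun i => hf.comp (by fun_prop)) fun i p => hf01 _) fun p => firstProd_mem_Icc fun i => hf01 _

/-- Averaging, over a uniform labelled tree, the product of the values of `f` on the first
`κ (y [])` branches. -/
theorem integral_tree_firstProd {E : Type*} [MeasurableSpace E] {d : Measure ℕ∞}
    [IsProbabilityMeasure d] {ρ : Measure E} [IsProbabilityMeasure ρ] {κ : E → ℕ∞}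
    (hκ : Measurable κ) (hκd : ρ.map κ = d) {f : (Vertex → E) → ℝ}
    (hf : Measurable f) (hf01 : ∀ e, f e ∈ Icc (0 : ℝ) 1) :
    ∫ y, firstProd (κ (y [])) (fun i => f (fun v => y (i :: v)))
        ∂(Measure.infinitePi fun _ : Vertex => ρ) =
      ∫ n, firstProd n (fun _ => ∫ y, f y ∂(Measure.infinitePi fun _ : Vertex => ρ)) ∂d := by
  rw [← integral_prod_firstProd d _ hf hf01, ← hκd]
  have h1 : ((ρ.map κ).prod (Measure.infinitePi fun _ : ℕ =>
      Measure.infinitePi fun _ : Vertex => ρ)) =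
      (Measure.infinitePi fun _ : Vertex => ρ).map
        (fun y => (κ (y []), fun (i : ℕ) (v : Vertex) => y (i :: v))) := by
    have := Measure.map_prod_map ρ (Measure.infinitePi fun _ : ℕ =>
      Measure.infinitePi fun _ : Vertex => ρ) hκ measurable_id
    rw [Measure.map_id] at this
    rw [this, ← infinitePi_map_branch, Measure.map_map (by fun_prop) (by fun_prop)]
    rfl
  rw [h1, integral_map]
  · exact Measurable.aemeasurable (by fun_prop)
  · exact (measurable_firstProd measurable_fst
      (fun i => hf.comp (by fun_prop)) fun i p => hf01 _).aestronglyMeasurable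

/-- Covariance of two solutions of the recursion driven by the same family sizes. -/
theorem integral_branch_mul {E : Type*} [MeasurableSpace E] {d : Measure ℕ∞}
    [IsProbabilityMeasure d] {ρ : Measure E} [IsProbabilityMeasure ρ] {κ : E → ℕ∞}
    (hκ : Measurable κ) (hκd : ρ.map κ = d) {f g : (Vertex → E) → ℝ}
    (hf : Measurable f) (hf01 : ∀ e, f e ∈ Icc (0 : ℝ) 1)
    (hg : Measurable g) (hg01 : ∀ e, g e ∈ Icc (0 : ℝ) 1) {m : ℝ} (hm1 : m < 1)
    (hm : pgf d m = 1 - m) (hfm : ∫ y, f y ∂(Measure.infinitePi fun _ : Vertex => ρ) = m)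
    (hgm : ∫ y, g y ∂(Measure.infinitePi fun _ : Vertex => ρ) = m) :
    ∫ y, (1 - firstProd (κ (y [])) (fun i => f (fun v => y (i :: v)))) *
        (1 - firstProd (κ (y [])) (fun i => g (fun v => y (i :: v))))
        ∂(Measure.infinitePi fun _ : Vertex => ρ) =
      2 * m - 1 + pgf d (∫ y, f y * g y ∂(Measure.infinitePi fun _ : Vertex => ρ)) := by
  set P := Measure.infinitePi fun _ : Vertex => ρ
  have hm0 : 0 ≤ m := hfm ▸ (integral_mem_Icc hf01).1
  have hfg01 : ∀ y, f y * g y ∈ Icc (0 : ℝ) 1 := fun y => mul_mem_Icc (hf01 y) (hg01 y)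
  have hfgm : ∫ y, f y * g y ∂P ≤ m := by
    rw [← hfm]
    exact integral_mono (integrable_of_mem_Icc (hf.mul hg) hfg01) (integrable_of_mem_Icc hf hf01)
      fun y => mul_le_of_le_one_right (hf01 y).1 (hg01 y).2
  -- The bound by m < 1 keeps the mean of h in the range where `pgf` computes the expected product;
  -- it is applied to f, g and fg.
  have key : ∀ h : (Vertex → E) → ℝ, Measurable h → (∀ e, h e ∈ Icc (0 : ℝ) 1) →
      ∫ y, h y ∂P ≤ m → Integrable (fun y => firstProd (κ (y [])) fun i => h fun v => y (i :: v)) P ∧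
      ∫ y, firstProd (κ (y [])) (fun i => h (fun v => y (i :: v))) ∂P = pgf d (∫ y, h y ∂P) := by
    intro h hh hh01 hhm
    constructor
    · refine integrable_of_mem_Icc (measurable_firstProd (hκ.comp (measurable_pi_apply _))
        (fun i => hh.comp (by fun_prop)) fun i p => hh01 _) fun p => firstProd_mem_Icc fun i => hh01 _
    · rw [integral_tree_firstProd hκ hκd hh hh01, integral_firstProd_const d
        (integral_mem_Icc hh01).1 (hhm.trans_lt hm1)]
  obtain ⟨i1, e1⟩ := key f hf hf01 hfm.le
  obtain ⟨i2, e2⟩ := key g hg hg01 hgm.le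
  obtain ⟨i3, e3⟩ := key (fun y => f y * g y) (hf.mul hg) hfg01 hfgm
  -- The two products have the same length, so their product is that of fg over the branches. Each
  -- linear term has mean H(m) = 1 − m, whence the constant 1 − 2(1 − m) = 2m − 1.
  calc _ = ∫ y, (1 - firstProd (κ (y [])) (fun i => f (fun v => y (i :: v))) -
        firstProd (κ (y [])) (fun i => g (fun v => y (i :: v))) +
        firstProd (κ (y [])) (fun i => (fun y => f y * g y) (fun v => y (i :: v)))) ∂P := by
        refine integral_congr_ae (ae_of_all _ fun y => ?_)
        simp only
        rw [← firstProd_mul (fun i => hf01 _) (fun i => hg01 _)]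
        ring
    _ = _ := by
        have j1 := (integrable_const (μ := P) (1 : ℝ)).sub i1
        have s1 := integral_sub (integrable_const (μ := P) (1 : ℝ)) i1
        have s2 := integral_sub j1 i2
        have s3 := integral_add (j1.sub i2) i3
        simp only [Pi.sub_apply] at s2 s3
        rw [s3, s2, s1, e1, e2, e3, hfm, hgm, hm]
        simp
        ring

theorem integral_branch {E : Type*} [MeasurableSpace E] {d : Measure ℕ∞}
    [IsProbabilityMeasure d] {ρ : Measure E} [IsProbabilityMeasure ρ] {κ : E → ℕ∞}
    (hκ : Measurable κ) (hκd : ρ.map κ = d) {f : (Vertex → E) → ℝ}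
    (hf : Measurable f) (hf01 : ∀ e, f e ∈ Icc (0 : ℝ) 1) {m : ℝ} (hm1 : m < 1)
    (hm : pgf d m = 1 - m) (hfm : ∫ y, f y ∂(Measure.infinitePi fun _ : Vertex => ρ) = m) :
    ∫ y, (1 - firstProd (κ (y [])) (fun i => f (fun v => y (i :: v))))
        ∂(Measure.infinitePi fun _ : Vertex => ρ) = m := by
  have hm0 : 0 ≤ m := hfm ▸ (integral_mem_Icc hf01).1
  rw [integral_sub (integrable_const _), integral_tree_firstProd hκ hκd hf hf01, hfm,
    integral_firstProd_const d hm0 hm1, hm]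
  · simp
  · exact integrable_of_mem_Icc (measurable_firstProd (hκ.comp (measurable_pi_apply _))
      (fun i => hf.comp (by fun_prop)) fun i p => hf01 _) fun p => firstProd_mem_Icc fun i => hf01 _

/-! ### Evaluation of the recursion on finitely many generations -/

/-- Truncation of a real number to `[0,1]`. -/
noncomputable def unitClamp (t : ℝ) : ℝ := max 0 (min 1 t)

theorem unitClamp_mem_Icc (t : ℝ) : unitClamp t ∈ Icc (0 : ℝ) 1 :=
  ⟨le_max_left _ _, max_le zero_le_one (min_le_left _ _)⟩

theorem unitClamp_of_mem {t : ℝ} (ht : t ∈ Icc (0 : ℝ) 1) : unitClamp t = t := by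
  rw [unitClamp, min_eq_right ht.2, max_eq_right ht.1]

theorem measurable_unitClamp : Measurable unitClamp := by
  unfold unitClamp
  fun_prop

/-- The value at the root obtained from the boundary values `x` at depth `k` by running the
recursion with family sizes `z`. -/
noncomputable def treeValue : ℕ → (Vertex → ℕ∞) → (Vertex → ℝ) → ℝ
  | 0, _, x => unitClamp (x [])
  | k + 1, z, x =>
    1 - firstProd (z []) fun i => treeValue k (fun v => z (i :: v)) fun v => x (i :: v)

theorem treeValue_zero (z : Vertex → ℕ∞) (x : Vertex → ℝ) :
    treeValue 0 z x = unitClamp (x []) := rfl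

theorem treeValue_succ (k : ℕ) (z : Vertex → ℕ∞) (x : Vertex → ℝ) :
    treeValue (k + 1) z x =
      1 - firstProd (z []) fun i => treeValue k (fun v => z (i :: v)) fun v => x (i :: v) := rfl

theorem treeValue_mem_Icc (k : ℕ) (z : Vertex → ℕ∞) (x : Vertex → ℝ) :
    treeValue k z x ∈ Icc (0 : ℝ) 1 := by
  induction k generalizing z x with
  | zero => exact unitClamp_mem_Icc _
  | succ k ih => exact one_sub_firstProd_mem_Icc fun i => ih _ _

theorem measurable_treeValue (k : ℕ) :
    Measurable fun p : (Vertex → ℕ∞) × (Vertex → ℝ) => treeValue k p.1 p.2 := by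
  induction k with
  | zero => exact measurable_unitClamp.comp (by fun_prop)
  | succ k ih =>
    have hn : Measurable fun p : (Vertex → ℕ∞) × (Vertex → ℝ) => p.1 [] := by fun_prop
    have hs : ∀ i : ℕ, Measurable fun p : (Vertex → ℕ∞) × (Vertex → ℝ) =>
        ((fun v => p.1 (i :: v) : Vertex → ℕ∞), (fun v => p.2 (i :: v) : Vertex → ℝ)) := by
      intro i
      fun_prop
    exact measurable_const.sub
      (measurable_firstProd hn (fun i => ih.comp (hs i)) fun i p => treeValue_mem_Icc _ _ _)

theorem Measurable.treeValue {α : Type*} [MeasurableSpace α] (k : ℕ) {z : α → Vertex → ℕ∞}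
    {x : α → Vertex → ℝ} (hz : Measurable z) (hx : Measurable x) :
    Measurable fun a => treeValue k (z a) (x a) :=
  (measurable_treeValue k).comp (hz.prodMk hx)

/-- Makes default labels harmless when sizes are known only above depth k and boundary values only
at depth k. -/
theorem treeValue_congr {k : ℕ} {z z' : Vertex → ℕ∞} {x x' : Vertex → ℝ}
    (hz : ∀ v, v.length < k → z v = z' v) (hx : ∀ v, v.length = k → x v = x' v) :
    treeValue k z x = treeValue k z' x' := by
  induction k generalizing z z' x x' with
  | zero => rw [treeValue_zero, treeValue_zero, hx [] rfl]
  | succ k ih =>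
    rw [treeValue_succ, treeValue_succ, hz [] (by simp)]
    congr 2
    funext i
    exact ih (fun v hv => hz _ (by simpa using hv)) fun v hv => hx _ (by simpa using hv)

theorem ae_infinitePi_mem {ι : Type*} [Countable ι] {E : Type*} [MeasurableSpace E] {ν : Measure E}
    [IsProbabilityMeasure ν] {s : Set E} (hs : ∀ᵐ x ∂ν, x ∈ s) :
    ∀ᵐ x ∂(Measure.infinitePi fun _ : ι => ν), ∀ i, x i ∈ s :=
  ae_all_iff.2 fun i =>
    (measurePreserving_eval_infinitePi (fun _ : ι => ν) i).quasiMeasurePreserving.ae hs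

theorem integral_unitClamp_eval {ι : Type*} {ν : Measure ℝ} [IsProbabilityMeasure ν]
    (h01 : ∀ᵐ x ∂ν, x ∈ Icc (0 : ℝ) 1) (i : ι) :
    ∫ x, unitClamp (x i) ∂(Measure.infinitePi fun _ : ι => ν) = ∫ t, t ∂ν := by
  have h := (measurePreserving_eval_infinitePi (fun _ : ι => ν) i).map_eq
  calc _ = ∫ t, unitClamp t ∂ν := by
        rw [← h, integral_map (measurable_pi_apply i).aemeasurable
          measurable_unitClamp.aestronglyMeasurable, h]
    _ = _ := integral_congr_ae (h01.mono fun t ht => unitClamp_of_mem ht)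

/-- Averaging over independent boundary values amounts to replacing them by their mean. -/
theorem integral_treeValue {ν : Measure ℝ} [IsProbabilityMeasure ν]
    (h01 : ∀ᵐ x ∂ν, x ∈ Icc (0 : ℝ) 1) (k : ℕ) (z : Vertex → ℕ∞) :
    ∫ x, treeValue k z x ∂(Measure.infinitePi fun _ : Vertex => ν) =
      treeValue k z fun _ => ∫ t, t ∂ν := by
  induction k generalizing z with
  | zero =>
    rw [treeValue_zero, unitClamp_of_mem]
    · exact integral_unitClamp_eval h01 _
    · rw [← integral_unitClamp_eval h01 ()]
      exact integral_mem_Icc fun _ => unitClamp_mem_Icc _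
  | succ k ih =>
    have hco : iIndepFun (fun (v : Vertex) (y : Vertex → ℝ) => y v)
        (Measure.infinitePi fun _ : Vertex => ν) :=
      iIndepFun_infinitePi (X := fun _ x => x) fun _ => measurable_id
    have hbl := iIndepFun_blocks (fun v => measurable_pi_apply v) hco
      (e := fun (i : ℕ) (v : Vertex) => i :: v) (by rintro ⟨a, b⟩ ⟨c, d⟩ h; simpa using h)
    have hmeas : ∀ z : Vertex → ℕ∞, Measurable fun x : Vertex → ℝ => treeValue k z x := fun z =>
      Measurable.treeValue k measurable_const measurable_id
    have hbl' := hbl.comp (fun i x => treeValue k (fun v => z (i :: v)) x) fun i => hmeas _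
    -- For fixed sizes the branches are independent, so the mean of the product is the product of
    -- the branch means, each given by the induction hypothesis.
    have h1 := integral_firstProd (fun i => (hmeas _).comp (by fun_prop))
      (fun i x => treeValue_mem_Icc _ _ _) hbl' (z [])
    simp only [treeValue_succ]
    rw [integral_sub (integrable_const _)]
    · simp only [Function.comp_def] at h1
      rw [h1]
      simp only [integral_const, probReal_univ, smul_eq_mul, mul_one]
      congr 2
      funext i
      rw [← ih]
      have h2 := Measure.map_infinitePi_infinitePi_of_inj (P := fun _ : Vertex => ν)
        (f := fun v : Vertex => i :: v) List.cons_injective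
      conv_rhs => rw [← h2]
      rw [integral_map (Measurable.aemeasurable (by fun_prop)) (hmeas _).aestronglyMeasurable]
    · exact integrable_of_mem_Icc (measurable_firstProd measurable_const
        (fun i => (hmeas _).comp (by fun_prop)) fun i x => treeValue_mem_Icc _ _ _)
        fun x => firstProd_mem_Icc fun i => treeValue_mem_Icc _ _ _

/-- Second moments of the tree values with constant boundary value `m`. -/
noncomputable def momentIter (d : Measure ℕ∞) (m : ℝ) : ℕ → ℝ
  | 0 => m * m
  | n + 1 => 2 * m - 1 + pgf d (momentIter d m n)

/-- The equation H(m) = 1 − m preserves the mean at each generation. The label space E with its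
projection κ covers both trees carrying sizes alone and trees carrying sizes with boundary values.
-/
theorem integral_treeValue_const {E : Type*} [MeasurableSpace E] {d : Measure ℕ∞}
    [IsProbabilityMeasure d] {ρ : Measure E} [IsProbabilityMeasure ρ] {κ : E → ℕ∞}
    (hκ : Measurable κ) (hκd : ρ.map κ = d) {m : ℝ} (hm0 : 0 ≤ m) (hm1 : m < 1)
    (hm : pgf d m = 1 - m) (k : ℕ) :
    ∫ y, treeValue k (fun v => κ (y v)) (fun _ => m) ∂(Measure.infinitePi fun _ : Vertex => ρ)
      = m := by
  induction k with
  | zero => simp [treeValue_zero, unitClamp_of_mem ⟨hm0, hm1.le⟩]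
  | succ k ih =>
    exact integral_branch hκ hκd (Measurable.treeValue k (by fun_prop) measurable_const)
      (fun _ => treeValue_mem_Icc _ _ _) hm1 hm ih

theorem integral_treeValue_const_sq {E : Type*} [MeasurableSpace E] {d : Measure ℕ∞}
    [IsProbabilityMeasure d] {ρ : Measure E} [IsProbabilityMeasure ρ] {κ : E → ℕ∞}
    (hκ : Measurable κ) (hκd : ρ.map κ = d) {m : ℝ} (hm0 : 0 ≤ m) (hm1 : m < 1)
    (hm : pgf d m = 1 - m) (k : ℕ) :
    ∫ y, treeValue k (fun v => κ (y v)) (fun _ => m) * treeValue k (fun v => κ (y v)) (fun _ => m)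
      ∂(Measure.infinitePi fun _ : Vertex => ρ) = momentIter d m k := by
  induction k with
  | zero => simp [treeValue_zero, unitClamp_of_mem ⟨hm0, hm1.le⟩, momentIter]
  | succ k ih =>
    have hmeas : Measurable fun y : Vertex → E => treeValue k (fun v => κ (y v)) (fun _ => m) :=
      Measurable.treeValue k (by fun_prop) measurable_const
    rw [momentIter, ← ih]
    exact integral_branch_mul hκ hκd hmeas (fun _ => treeValue_mem_Icc _ _ _)
      hmeas (fun _ => treeValue_mem_Icc _ _ _) hm1 hm
      (integral_treeValue_const hκ hκd hm0 hm1 hm k) (integral_treeValue_const hκ hκd hm0 hm1 hm k)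

/-! ### Invariant laws as boundary laws of the tree -/

theorem measurable_one_sub_firstProd_unitClamp :
    Measurable fun p : ℕ∞ × (ℕ → ℝ) => 1 - firstProd p.1 fun i => unitClamp (p.2 i) :=
  measurable_const.sub (measurable_firstProd measurable_fst
    (fun i => measurable_unitClamp.comp (by fun_prop)) fun i p => unitClamp_mem_Icc _)

/-- Measurability of the random product is available for factors in [0,1]; clamping gives an
everywhere measurable map that agrees almost surely with the original. -/
theorem rdeMap_eq_map_unitClamp (d : Measure ℕ∞) [IsProbabilityMeasure d] (ν : Measure ℝ)
    [IsProbabilityMeasure ν] (h01 : ∀ᵐ x ∂ν, x ∈ Icc (0 : ℝ) 1) :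
    rdeMap d ν = (d.prod (Measure.infinitePi fun _ : ℕ => ν)).map
      fun p : ℕ∞ × (ℕ → ℝ) => 1 - firstProd p.1 fun i => unitClamp (p.2 i) := by
  refine Measure.map_congr ?_
  have h : ∀ᵐ p ∂(d.prod (Measure.infinitePi fun _ : ℕ => ν)), ∀ i, p.2 i ∈ Icc (0 : ℝ) 1 :=
    Measure.quasiMeasurePreserving_snd.ae (ae_infinitePi_mem h01)
  filter_upwards [h] with p hp
  congr 2
  funext i
  exact (unitClamp_of_mem (hp i)).symm

/-- Boundary values with an invariant law give an invariant law at the root. -/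
theorem map_treeValue_of_invariant {d : Measure ℕ∞} [IsProbabilityMeasure d] {ν : Measure ℝ}
    [IsProbabilityMeasure ν] (h01 : ∀ᵐ x ∂ν, x ∈ Icc (0 : ℝ) 1) (hν : rdeMap d ν = ν) (k : ℕ) :
    (Measure.infinitePi fun _ : Vertex => d.prod ν).map
      (fun y => treeValue k (fun v => (y v).1) fun v => (y v).2) = ν := by
  induction k with
  | zero =>
    have h1 : (Measure.infinitePi fun _ : Vertex => d.prod ν).map (fun y => y []) = d.prod ν :=
      Measure.infinitePi_map_eval _ _
    have h2 : ν.map unitClamp = ν := by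
      conv_rhs => rw [← Measure.map_id (μ := ν)]
      exact Measure.map_congr (h01.mono fun x hx => unitClamp_of_mem hx)
    calc _ = (((Measure.infinitePi fun _ : Vertex => d.prod ν).map (fun y => y [])).map
          Prod.snd).map unitClamp := by
          rw [Measure.map_map measurable_snd (by fun_prop),
            Measure.map_map measurable_unitClamp (by fun_prop)]
          rfl
      _ = ν := by
          rw [h1, Measure.map_snd_prod]
          simp [h2]
  | succ k ih =>
    set P := Measure.infinitePi fun _ : Vertex => d.prod ν
    have hmeas : Measurable fun y : Vertex → ℕ∞ × ℝ =>
        treeValue k (fun v => (y v).1) fun v => (y v).2 :=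
      Measurable.treeValue k (by fun_prop) (by fun_prop)
    -- The root size and the values of the branches have exactly the joint law fed into `rdeMap`, so
    -- one more generation applies `rdeMap` once to ν.
    have h1 : (P.map fun y => ((y []).1, fun i : ℕ =>
        treeValue k (fun v => (y (i :: v)).1) fun v => (y (i :: v)).2)) =
        d.prod (Measure.infinitePi fun _ : ℕ => ν) := by
      have h2 := Measure.infinitePi_map_pi (fun _ : ℕ => P) fun _ => hmeas
      rw [ih] at h2
      have h3 : (d.prod ν).map Prod.fst = d := by simp [Measure.map_fst_prod]
      have h4 := Measure.map_prod_map (d.prod ν) (Measure.infinitePi fun _ : ℕ => P)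
        (measurable_fst) (g := fun x (i : ℕ) =>
          treeValue k (fun v => (x i v).1) fun v => (x i v).2) (measurable_pi_lambda _ fun i =>
            hmeas.comp (measurable_pi_apply i))
      rw [h2, h3] at h4
      rw [h4, ← infinitePi_map_branch, Measure.map_map _ (by fun_prop)]
      · rfl
      · exact (measurable_fst.comp measurable_fst).prodMk (measurable_pi_lambda _ fun i =>
            hmeas.comp ((measurable_pi_apply i).comp measurable_snd))
    conv_rhs => rw [← hν, rdeMap_eq_map_unitClamp d ν h01, ← h1]
    rw [Measure.map_map measurable_one_sub_firstProd_unitClamp]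
    · congr 1
      funext y
      simp only [treeValue_succ, Function.comp_apply]
      congr 2
      funext i
      exact (unitClamp_of_mem (treeValue_mem_Icc _ _ _)).symm
    · exact (measurable_fst.comp (measurable_pi_apply [])).prodMk (measurable_pi_lambda _ fun i =>
            hmeas.comp (by fun_prop))

section Invariant

variable {d : Measure ℕ∞} [IsProbabilityMeasure d] {ν : Measure ℝ} [IsProbabilityMeasure ν]

theorem measurable_treeValue_pair (k : ℕ) : Measurable fun y : Vertex → ℕ∞ × ℝ =>
    treeValue k (fun v => (y v).1) fun v => (y v).2 :=
  Measurable.treeValue k (by fun_prop) (by fun_prop)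

theorem integral_comp_treeValue_of_invariant (h01 : ∀ᵐ x ∂ν, x ∈ Icc (0 : ℝ) 1)
    (hν : rdeMap d ν = ν) (k : ℕ) {φ : ℝ → ℝ} (hφ : Measurable φ) :
    ∫ y, φ (treeValue k (fun v => (y v).1) fun v => (y v).2)
      ∂(Measure.infinitePi fun _ : Vertex => d.prod ν) = ∫ t, φ t ∂ν := by
  conv_rhs => rw [← map_treeValue_of_invariant h01 hν k]
  rw [integral_map (measurable_treeValue_pair k).aemeasurable hφ.aestronglyMeasurable]

omit [IsProbabilityMeasure d] in
theorem map_fst_prod_prob : (d.prod ν).map Prod.fst = d := by simp [Measure.map_fst_prod]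

/-- Depths 0 and 1 have the same mean m, so m = 1 − E[m^N]. If m were 1, the product would be 1 and
the equation would read 1 = 0. -/
theorem mean_of_invariant (h01 : ∀ᵐ x ∂ν, x ∈ Icc (0 : ℝ) 1) (hν : rdeMap d ν = ν) :
    0 ≤ ∫ t, t ∂ν ∧ ∫ t, t ∂ν < 1 ∧ pgf d (∫ t, t ∂ν) = 1 - ∫ t, t ∂ν := by
  have h0 := integral_comp_treeValue_of_invariant h01 hν 0 measurable_id
  have h1 := integral_comp_treeValue_of_invariant h01 hν 1 measurable_id
  simp only [id] at h0 h1
  set m := ∫ t, t ∂ν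
  have hm01 : m ∈ Icc (0 : ℝ) 1 := by
    rw [← h0]
    exact integral_mem_Icc fun _ => treeValue_mem_Icc _ _ _
  have h2 := integral_tree_firstProd (d := d) (ρ := d.prod ν) (κ := Prod.fst) measurable_fst
    map_fst_prod_prob (measurable_treeValue_pair 0) (fun _ => treeValue_mem_Icc _ _ _)
  rw [h0] at h2
  have h3 : m = 1 - ∫ n, firstProd n (fun _ => m) ∂d := by
    conv_lhs => rw [← h1]
    rw [← h2]
    simp only [treeValue_succ]
    rw [integral_sub (integrable_const _)]
    · simp
    · exact integrable_of_mem_Icc (measurable_firstProd (by fun_prop)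
        (fun i => (measurable_treeValue_pair 0).comp (f := fun (y : Vertex → ℕ∞ × ℝ) (v : Vertex) => y (i :: v)) (by fun_prop))
          fun i p => treeValue_mem_Icc _ _ _)
        fun p => firstProd_mem_Icc fun i => treeValue_mem_Icc _ _ _
  have hlt : m < 1 := by
    refine lt_of_le_of_ne hm01.2 fun h => ?_
    rw [h] at h3
    simp [firstProd_one] at h3
  refine ⟨hm01.1, hlt, ?_⟩
  rw [integral_firstProd_const d hm01.1 hlt] at h3
  linarith

theorem integral_mul_self_of_invariant (h01 : ∀ᵐ x ∂ν, x ∈ Icc (0 : ℝ) 1)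
    (hν : rdeMap d ν = ν) :
    ∫ t, t * t ∂ν = 2 * (∫ t, t ∂ν) - 1 + pgf d (∫ t, t * t ∂ν) := by
  obtain ⟨hm0, hm1, hm⟩ := mean_of_invariant h01 hν
  have hmean := integral_comp_treeValue_of_invariant h01 hν 0 measurable_id
  have hsq : Measurable fun t : ℝ => t * t := by fun_prop
  have h0 := integral_comp_treeValue_of_invariant h01 hν 0 hsq
  have h1 := integral_comp_treeValue_of_invariant h01 hν 1 hsq
  conv_lhs => rw [← h1]
  rw [← h0]
  exact integral_branch_mul (κ := Prod.fst) measurable_fst map_fst_prod_prob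
    (measurable_treeValue_pair 0) (fun _ => treeValue_mem_Icc _ _ _)
    (measurable_treeValue_pair 0) (fun _ => treeValue_mem_Icc _ _ _) hm1 hm hmean hmean

/-- The mixed moment follows the same iteration as the second moment of the constant-boundary
values, and starts at the same point m·m because at depth 0 one factor is the constant m. -/
theorem integral_treeValue_mul_const (h01 : ∀ᵐ x ∂ν, x ∈ Icc (0 : ℝ) 1)
    (hν : rdeMap d ν = ν) (k : ℕ) :
    ∫ y, treeValue k (fun v => (y v).1) (fun v => (y v).2) *
        treeValue k (fun v => (y v).1) (fun _ => ∫ t, t ∂ν)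
      ∂(Measure.infinitePi fun _ : Vertex => d.prod ν) = momentIter d (∫ t, t ∂ν) k := by
  obtain ⟨hm0, hm1, hm⟩ := mean_of_invariant h01 hν
  have hmean := fun k => integral_comp_treeValue_of_invariant h01 hν k measurable_id
  simp only [id] at hmean
  set m := ∫ t, t ∂ν
  induction k with
  | zero =>
    have := hmean 0
    simp only [treeValue_zero, unitClamp_of_mem (t := m) ⟨hm0, hm1.le⟩, momentIter] at this ⊢
    rw [integral_mul_const, this]
  | succ k ih =>
    rw [momentIter, ← ih]
    exact integral_branch_mul (κ := Prod.fst) measurable_fst map_fst_prod_prob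
      (measurable_treeValue_pair k) (fun _ => treeValue_mem_Icc _ _ _)
      (Measurable.treeValue k (by fun_prop) measurable_const) (fun _ => treeValue_mem_Icc _ _ _)
      hm1 hm (hmean k)
      (integral_treeValue_const measurable_fst map_fst_prod_prob hm0 hm1 hm k)

/-- The squared distance between the tree values with boundary law `ν` and those with the constant
boundary value given by the mean of `ν`. -/
theorem integral_treeValue_sub_sq (h01 : ∀ᵐ x ∂ν, x ∈ Icc (0 : ℝ) 1)
    (hν : rdeMap d ν = ν) (k : ℕ) :
    ∫ y, (treeValue k (fun v => (y v).1) (fun v => (y v).2) -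
        treeValue k (fun v => (y v).1) (fun _ => ∫ t, t ∂ν)) ^ 2
      ∂(Measure.infinitePi fun _ : Vertex => d.prod ν) =
      (∫ t, t * t ∂ν) - momentIter d (∫ t, t ∂ν) k := by
  obtain ⟨hm0, hm1, hm⟩ := mean_of_invariant h01 hν
  have hsq : Measurable fun t : ℝ => t * t := by fun_prop
  have e1 := integral_comp_treeValue_of_invariant h01 hν k hsq
  have e2 := integral_treeValue_mul_const h01 hν k
  have e3 := integral_treeValue_const_sq (κ := Prod.fst) measurable_fst
    (map_fst_prod_prob (d := d) (ν := ν)) hm0 hm1 hm k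
  set m := ∫ t, t ∂ν
  set P := Measure.infinitePi fun _ : Vertex => d.prod ν
  have hG := measurable_treeValue_pair k
  have hF : Measurable fun y : Vertex → ℕ∞ × ℝ => treeValue k (fun v => (y v).1) (fun _ => m) :=
    Measurable.treeValue k (by fun_prop) measurable_const
  have i1 := integrable_of_mem_Icc (μ := P) (hG.mul hG) fun y =>
    mul_mem_Icc (treeValue_mem_Icc _ _ _) (treeValue_mem_Icc _ _ _)
  have i2 := integrable_of_mem_Icc (μ := P) (hG.mul hF) fun y =>
    mul_mem_Icc (treeValue_mem_Icc _ _ _) (treeValue_mem_Icc _ _ _)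
  have i3 := integrable_of_mem_Icc (μ := P) (hF.mul hF) fun y =>
    mul_mem_Icc (treeValue_mem_Icc _ _ _) (treeValue_mem_Icc _ _ _)
  have s1 := integral_sub i1 (i2.const_mul 2)
  have s2 := integral_add (i1.sub (i2.const_mul 2)) i3
  simp only [Pi.sub_apply, Pi.mul_apply] at s1 s2
  rw [s1, integral_const_mul, e1, e2, e3] at s2
  -- The cross term and the last square have the same expectation, so the expansion collapses.
  rw [show (∫ t, t * t ∂ν) - momentIter d m k =
    (∫ t, t * t ∂ν) - 2 * momentIter d m k + momentIter d m k by ring, ← s2]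
  refine integral_congr_ae (ae_of_all _ fun y => ?_)
  simp only
  ring

end Invariant

/-! ### Tree solutions conditioned on the family sizes -/

section TreeSolution

variable {Ω : Type*} [MeasurableSpace Ω] {μ : Measure Ω} [IsProbabilityMeasure μ]
  {d : Measure ℕ∞} [IsProbabilityMeasure d] {N : Vertex → Ω → ℕ∞} {X : Vertex → Ω → ℝ}

omit [IsProbabilityMeasure μ] in
theorem IsTreeSolution.map_eq (hX : IsTreeSolution μ N X) (u v : Vertex) :
    μ.map (X u) = μ.map (X v) := (hX.stationary u v).map_eq

theorem IsTreeSolution.isProbabilityMeasure_map (hX : IsTreeSolution μ N X) (u : Vertex) :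
    IsProbabilityMeasure (μ.map (X u)) :=
  Measure.isProbabilityMeasure_map (hX.measurable u).aemeasurable

omit [IsProbabilityMeasure μ] in
theorem IsTreeSolution.ae_mem_map (hX : IsTreeSolution μ N X) (u : Vertex) :
    ∀ᵐ x ∂(μ.map (X u)), x ∈ Icc (0 : ℝ) 1 :=
  (ae_map_iff (hX.measurable u).aemeasurable measurableSet_Icc).2 (hX.mem_Icc u)

/-- Only the root has depth less than 1, so the conditions at level 1 give independent daughters,
independent of the root size; the recursion at the root is then the invariance equation. -/
theorem IsTreeSolution.isInvariantLaw (hX : IsTreeSolution μ N X) (hNmeas : ∀ u, Measurable (N u))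
    (hNlaw : ∀ u, μ.map (N u) = d) : IsInvariantLaw d (μ.map (X [])) := by
  have hp := hX.isProbabilityMeasure_map []
  refine ⟨hp, hX.ae_mem_map [], ?_⟩
  rw [rdeMap_eq_map_unitClamp d _ (hX.ae_mem_map [])]
  have hroot : Measurable fun z : {v : Vertex // v.length < 1} → ℕ∞ => z ⟨[], zero_lt_one⟩ :=
    measurable_pi_apply _
  have hchild : Measurable fun (x : {v : Vertex // v.length = 1} → ℝ) (i : ℕ) => x ⟨[i], rfl⟩ :=
    measurable_pi_lambda _ fun i => measurable_pi_apply _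
  have hind := (hX.indep_above 1).comp hchild hroot
  have hlev := ((hX.iIndep_level 1).precomp (g := fun i : ℕ => ⟨[i], rfl⟩)
    (fun i j h => by simpa using h)).map_fun_eq_infinitePi_map fun i => hX.measurable _
  have hfam : Measurable fun ω (i : ℕ) => X [i] ω := measurable_pi_lambda _ fun i => hX.measurable _
  have h1 := (indepFun_iff_map_prod_eq_prod_map_map (hNmeas []).aemeasurable
    hfam.aemeasurable).1 hind.symm
  have h2 : (μ.map fun ω (i : ℕ) => X [i] ω) = Measure.infinitePi fun _ : ℕ => μ.map (X []) := by
    refine hlev.trans ?_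
    congr 1
    funext i
    exact hX.map_eq _ _
  rw [hNlaw, h2] at h1
  rw [← h1, Measure.map_map measurable_one_sub_firstProd_unitClamp ((hNmeas []).prodMk hfam)]
  refine Measure.map_congr ?_
  filter_upwards [hX.recursion [], ae_all_iff.2 fun i : ℕ => hX.mem_Icc [i]] with ω h3 h4
  rw [h3]
  simp only [Function.comp_apply, List.nil_append]
  congr 2
  funext i
  exact unitClamp_of_mem (h4 i)

omit [IsProbabilityMeasure μ] in
theorem IsTreeSolution.ae_eq_treeValue (hX : IsTreeSolution μ N X) (k : ℕ) (u : Vertex) :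
    X u =ᵐ[μ] fun ω => treeValue k (fun v => N (u ++ v) ω) fun v => X (u ++ v) ω := by
  induction k generalizing u with
  | zero =>
    filter_upwards [hX.mem_Icc u] with ω h
    rw [treeValue_zero, List.append_nil, unitClamp_of_mem h]
  | succ k ih =>
    filter_upwards [hX.recursion u, ae_all_iff.2 fun i : ℕ => ih (u ++ [i])] with ω h1 h2
    rw [h1, treeValue_succ, List.append_nil]
    congr 2
    funext i
    rw [h2 i]
    simp

/-- Extension of a function on a set of vertices by a constant. -/
noncomputable def extendVertex {α : Type*} (p : Vertex → Prop) (a : α) (z : {v // p v} → α)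
    (v : Vertex) : α :=
  open Classical in if h : p v then z ⟨v, h⟩ else a

theorem measurable_extendVertex {α : Type*} [MeasurableSpace α] (p : Vertex → Prop) (a : α) :
    Measurable (extendVertex p a) := by
  refine measurable_pi_lambda _ fun v => ?_
  unfold extendVertex
  split_ifs
  · exact measurable_pi_apply _
  · exact measurable_const

theorem extendVertex_of_mem {α : Type*} {p : Vertex → Prop} (a : α) (z : {v // p v} → α)
    {v : Vertex} (h : p v) : extendVertex p a z v = z ⟨v, h⟩ := by
  simp [extendVertex, h]

/-- The filtration generated by the family sizes, generation by generation. -/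
noncomputable def familyFiltration (hNmeas : ∀ u, Measurable (N u)) :
    Filtration ℕ ‹MeasurableSpace Ω› where
  seq n := MeasurableSpace.comap (fun ω (v : {v : Vertex // v.length < n}) => N v.1 ω)
    MeasurableSpace.pi
  mono' i j hij := by
    simp only [comap_pi_eq_iSup]
    exact iSup_le fun v => le_iSup_of_le ⟨v.1, v.2.trans_le hij⟩ le_rfl
  le' n := (measurable_pi_lambda _ fun v => hNmeas _).comap_le

theorem iSup_familyFiltration (hNmeas : ∀ u, Measurable (N u)) :
    ⨆ n, familyFiltration hNmeas n = familySigma N := by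
  have h : ∀ n, familyFiltration hNmeas n =
    ⨆ v : {v : Vertex // v.length < n}, MeasurableSpace.comap (N v.1) inferInstance :=
    fun n => comap_pi_eq_iSup _
  simp only [h]
  refine le_antisymm (iSup_le fun n => iSup_le fun v => le_iSup_of_le v.1 le_rfl)
    (iSup_le fun v => le_iSup_of_le (v.length + 1) (le_iSup_of_le ⟨v, Nat.lt_succ_self _⟩ le_rfl))

omit [IsProbabilityMeasure μ] in
theorem IsTreeSolution.map_level (hX : IsTreeSolution μ N X) (n : ℕ) (u₀ : Vertex) :
    (μ.map fun ω (w : {w : Vertex // w.length = n}) => X w.1 ω) =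
      Measure.infinitePi fun _ : {w : Vertex // w.length = n} => μ.map (X u₀) := by
  refine ((hX.iIndep_level n).map_fun_eq_infinitePi_map fun w => hX.measurable _).trans ?_
  have h : ∀ w : {w : Vertex // w.length = n}, μ.map (X w.1) = μ.map (X u₀) :=
    fun w => hX.map_eq _ _
  simp only [h]

/-- Given the family sizes in the generations before the boundary, the mean of a tree solution is
computed by replacing the boundary values with their mean. -/
theorem IsTreeSolution.condExp_familyFiltration (hX : IsTreeSolution μ N X)
    (hNmeas : ∀ u, Measurable (N u)) (u : Vertex) (k : ℕ) :
    μ[X u | familyFiltration hNmeas (u.length + k)] =ᵐ[μ]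
      fun ω => treeValue k (fun v => N (u ++ v) ω) fun _ => ∫ t, t ∂(μ.map (X u)) := by
  set n := u.length + k with hn
  set ν := μ.map (X u) with hνdef
  have hν : IsProbabilityMeasure ν := hX.isProbabilityMeasure_map u
  set Z : Ω → {v : Vertex // v.length < n} → ℕ∞ := fun ω v => N v.1 ω with hZdef
  set W : Ω → {w : Vertex // w.length = n} → ℝ := fun ω w => X w.1 ω with hWdef
  have hZ : Measurable Z := measurable_pi_lambda _ fun v => hNmeas _
  have hW : Measurable W := measurable_pi_lambda _ fun v => hX.measurable _
  -- Labels of the subtree at u, extended by 0 where unknown. `treeValue k` never reads the default,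
  -- since u ++ v has depth below n, or equal to n, exactly when v has depth below k, or equal to k.
  set ez : ({v : Vertex // v.length < n} → ℕ∞) → Vertex → ℕ∞ :=
    fun z v => extendVertex _ 0 z (u ++ v) with hez
  set ew : ({v : Vertex // v.length = n} → ℝ) → Vertex → ℝ :=
    fun w v => extendVertex _ 0 w (u ++ v) with hew
  have hezm : Measurable ez := measurable_pi_lambda _ fun v =>
    measurable_pi_iff.1 (measurable_extendVertex _ _) (u ++ v)
  have hewm : Measurable ew := measurable_pi_lambda _ fun v =>
    measurable_pi_iff.1 (measurable_extendVertex _ _) (u ++ v)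
  have hg : Measurable fun p : ({v : Vertex // v.length < n} → ℕ∞) ×
      ({w : Vertex // w.length = n} → ℝ) => treeValue k (ez p.1) (ew p.2) :=
    Measurable.treeValue k (hezm.comp measurable_fst) (hewm.comp measurable_snd)
  have hXg : X u =ᵐ[μ] fun ω => treeValue k (ez (Z ω)) (ew (W ω)) := by
    filter_upwards [hX.ae_eq_treeValue k u] with ω hω
    rw [hω]
    refine treeValue_congr (fun v hv => ?_) fun v hv => ?_
    · rw [hez, hZdef]
      simp only
      rw [extendVertex_of_mem _ _ (by simp [hn, hv])]
    · rw [hew, hWdef]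
      simp only
      rw [extendVertex_of_mem _ _ (by simp [hn, hv])]
  have hFZ : (fun ω => treeValue k (fun v => N (u ++ v) ω) fun _ => ∫ t, t ∂ν) =
      fun ω => treeValue k (ez (Z ω)) fun _ => ∫ t, t ∂ν := by
    funext ω
    refine treeValue_congr (fun v hv => ?_) fun v hv => rfl
    rw [hez, hZdef]
    simp only
    rw [extendVertex_of_mem _ _ (by simp [hn, hv])]
  have hF : Measurable fun z : {v : Vertex // v.length < n} → ℕ∞ =>
      treeValue k (ez z) fun _ => ∫ t, t ∂ν :=
    Measurable.treeValue k hezm measurable_const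
  -- With the sizes frozen, average over the boundary level, viewed as a restriction of a product
  -- measure on all vertices. Fubini then gives the conditional expectation, as sizes and boundary
  -- are independent.
  have hinner : ∀ z, ∫ w, treeValue k (ez z) (ew w) ∂(μ.map W) =
      treeValue k (ez z) fun _ => ∫ t, t ∂ν := by
    intro z
    have e : μ.map W = (Measure.infinitePi fun _ : Vertex => ν).map
        ({w : Vertex | w.length = n}).domRestrict :=
      (hX.map_level n u).trans (Measure.infinitePi_map_restrict' (fun _ : Vertex => ν)
        (I := {w : Vertex | w.length = n})).symm
    rw [e, integral_map, ← integral_treeValue (hX.ae_mem_map u)]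
    · have h2 := Measure.map_infinitePi_infinitePi_of_inj (P := fun _ : Vertex => ν)
        (f := fun v : Vertex => u ++ v) (List.append_right_injective u)
      conv_rhs => rw [← h2]
      have hmeas : Measurable fun x : Vertex → ℝ => treeValue k (ez z) x :=
        Measurable.treeValue k measurable_const measurable_id
      rw [integral_map (Measurable.aemeasurable (by fun_prop)) hmeas.aestronglyMeasurable]
      refine integral_congr_ae (ae_of_all _ fun x => ?_)
      refine treeValue_congr (fun v hv => rfl) fun v hv => ?_
      rw [hew]
      simp only
      rw [extendVertex_of_mem _ _ (by simp [hn, hv])]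
      rfl
    · exact (measurable_pi_lambda _ fun w => measurable_pi_apply w.1).aemeasurable
    · exact (Measurable.treeValue k measurable_const hewm).aestronglyMeasurable
  have hle := (familyFiltration hNmeas).le n
  have hXint : Integrable (X u) μ := (integrable_of_mem_Icc
    (hg.comp (hZ.prodMk hW)) fun ω => treeValue_mem_Icc _ _ _).congr hXg.symm
  have hmap := (indepFun_iff_map_prod_eq_prod_map_map hZ.aemeasurable hW.aemeasurable).1
    (hX.indep_above n).symm
  symm
  rw [hFZ]
  have hpW : IsProbabilityMeasure (μ.map W) := Measure.isProbabilityMeasure_map hW.aemeasurable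
  have hpZ : IsProbabilityMeasure (μ.map Z) := Measure.isProbabilityMeasure_map hZ.aemeasurable
  have hFint : Integrable (fun ω => treeValue k (ez (Z ω)) fun _ => ∫ t, t ∂ν) μ :=
    integrable_of_mem_Icc (hF.comp hZ) fun ω => treeValue_mem_Icc _ _ _
  refine ae_eq_condExp_of_forall_setIntegral_eq hle hXint (fun s _ _ => hFint.integrableOn) ?_ ?_
  · rintro _ ⟨B, hB, rfl⟩ -
    have e1 : ∫ ω in Z ⁻¹' B, X u ω ∂μ = ∫ ω in Z ⁻¹' B, treeValue k (ez (Z ω)) (ew (W ω)) ∂μ :=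
      integral_congr_ae (ae_restrict_of_ae hXg)
    have e2 := setIntegral_map (μ := μ) (g := fun ω => (Z ω, W ω)) (hB.prod MeasurableSet.univ)
      hg.aestronglyMeasurable (hZ.prodMk hW).aemeasurable
    have e3 := setIntegral_map (μ := μ) (g := Z) hB hF.aestronglyMeasurable hZ.aemeasurable
    rw [e1, ← e3]
    have hpre : (fun ω => (Z ω, W ω)) ⁻¹' (B ×ˢ univ) = Z ⁻¹' B := by
      ext ω
      simp
    rw [hpre, hmap, setIntegral_prod] at e2
    · simp only [Measure.restrict_univ, hinner] at e2
      exact e2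
    · exact (integrable_of_mem_Icc hg fun p => treeValue_mem_Icc _ _ _).integrableOn
  · exact StronglyMeasurable.aestronglyMeasurable
      (hF.comp (comap_measurable Z)).stronglyMeasurable

/-- The limit of the tree values with constant boundary value `m`. -/
noncomputable def treeLimit (m : ℝ) (z : Vertex → ℕ∞) : ℝ :=
  limsup (fun k => treeValue k z fun _ => m) atTop

/-- Convergence holds only almost surely; the upper limit provides a measurable function of the
whole size field. -/
theorem measurable_treeLimit (m : ℝ) : Measurable (treeLimit m) :=
  Measurable.limsup fun k => Measurable.treeValue k measurable_id measurable_const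

/-- Lévy's upward theorem along the generations, whose σ-algebras together generate the full family
σ-algebra. -/
theorem IsTreeSolution.ae_tendsto_condExp (hX : IsTreeSolution μ N X)
    (hNmeas : ∀ u, Measurable (N u)) (u : Vertex) :
    ∀ᵐ ω ∂μ, Tendsto (fun k => treeValue k (fun v => N (u ++ v) ω)
      fun _ => ∫ t, t ∂(μ.map (X []))) atTop (𝓝 ((μ[X u | familySigma N]) ω)) := by
  have h1 := tendsto_ae_condExp (μ := μ) (ℱ := familyFiltration hNmeas) (X u)
  rw [iSup_familyFiltration] at h1
  rw [hX.map_eq [] u]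
  filter_upwards [h1, ae_all_iff.2 fun k => hX.condExp_familyFiltration hNmeas u k] with ω h2 h3
  have h4 := (tendsto_add_atTop_iff_nat u.length).2 h2
  refine h4.congr fun k => ?_
  rw [add_comm, h3 k]

/-- The right side involves X only through its mean; this yields uniqueness of the endogenous
solution. -/
theorem IsTreeSolution.condExp_ae_eq_treeLimit (hX : IsTreeSolution μ N X)
    (hNmeas : ∀ u, Measurable (N u)) (u : Vertex) :
    μ[X u | familySigma N] =ᵐ[μ]
      fun ω => treeLimit (∫ t, t ∂(μ.map (X []))) fun v => N (u ++ v) ω := by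
  filter_upwards [hX.ae_tendsto_condExp hNmeas u] with ω h
  exact h.limsup_eq.symm

end TreeSolution

/-! ### The limit of the constant-boundary values solves the recursion -/

section LimitSolution

variable {Ω : Type*} [MeasurableSpace Ω] {μ : Measure Ω} [IsProbabilityMeasure μ]
  {d : Measure ℕ∞} [IsProbabilityMeasure d] {N : Vertex → Ω → ℕ∞} {Y : Vertex → Ω → ℝ} {m : ℝ}

omit [IsProbabilityMeasure μ] [IsProbabilityMeasure d] in
theorem map_subtree (hNmeas : ∀ u, Measurable (N u)) (hNlaw : ∀ u, μ.map (N u) = d)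
    (hNindep : iIndepFun N μ) (u : Vertex) :
    μ.map (fun ω v => N (u ++ v) ω) = Measure.infinitePi fun _ : Vertex => d := by
  refine ((hNindep.precomp (g := fun v => u ++ v)
    (List.append_right_injective u)).map_fun_eq_infinitePi_map fun v => hNmeas _).trans ?_
  simp only [hNlaw]

omit [IsProbabilityMeasure μ] [IsProbabilityMeasure d] in
theorem integral_comp_treeValue_subtree (hNmeas : ∀ u, Measurable (N u))
    (hNlaw : ∀ u, μ.map (N u) = d) (hNindep : iIndepFun N μ) (u : Vertex) (k : ℕ)
    {φ : ℝ → ℝ} (hφ : Measurable φ) :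
    ∫ ω, φ (treeValue k (fun v => N (u ++ v) ω) fun _ => m) ∂μ =
      ∫ z, φ (treeValue k z fun _ => m) ∂(Measure.infinitePi fun _ : Vertex => d) := by
  rw [← map_subtree hNmeas hNlaw hNindep u, integral_map]
  · exact (measurable_pi_lambda _ fun v => hNmeas _).aemeasurable
  · exact (hφ.comp (Measurable.treeValue k measurable_id measurable_const)).aestronglyMeasurable

omit [MeasurableSpace Ω] in
theorem mem_Icc_of_tendsto_treeValue {u : Vertex} {ω : Ω} (h : Tendsto (fun k =>
    treeValue k (fun v => N (u ++ v) ω) fun _ => m) atTop (𝓝 (Y u ω))) : Y u ω ∈ Icc (0 : ℝ) 1 :=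
  isClosed_Icc.mem_of_tendsto h (Eventually.of_forall fun _ => treeValue_mem_Icc _ _ _)

omit [IsProbabilityMeasure d] in
-- The subtree at every u carries the same product law, so the approximating integrals do not depend
-- on u; boundedness on [0,1] gives dominated convergence.
theorem tendsto_integral_comp_treeValue
    (hNmeas : ∀ u, Measurable (N u)) (hNlaw : ∀ u, μ.map (N u) = d) (hNindep : iIndepFun N μ)
    (u : Vertex) (hlim : ∀ᵐ ω ∂μ, Tendsto (fun k =>
      treeValue k (fun v => N (u ++ v) ω) fun _ => m) atTop (𝓝 (Y u ω)))
    {φ : ℝ → ℝ} (hφ : Continuous φ) :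
    Tendsto (fun k => ∫ z, φ (treeValue k z fun _ => m) ∂(Measure.infinitePi fun _ : Vertex => d))
      atTop (𝓝 (∫ ω, φ (Y u ω) ∂μ)) := by
  obtain ⟨C, hC⟩ := isCompact_Icc.exists_bound_of_continuousOn (hφ.continuousOn (s := Icc 0 1))
  have h := tendsto_integral_of_dominated_convergence (μ := μ)
    (F := fun k ω => φ (treeValue k (fun v => N (u ++ v) ω) fun _ => m)) (f := fun ω => φ (Y u ω))
    (fun _ => C) (fun k => (hφ.measurable.comp (Measurable.treeValue k
      (measurable_pi_lambda _ fun v => hNmeas _) measurable_const)).aestronglyMeasurable)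
    (integrable_const _) (fun k => ae_of_all _ fun ω => hC _ (treeValue_mem_Icc _ _ _))
    (hlim.mono fun ω h => (hφ.tendsto _).comp h)
  exact h.congr fun k => integral_comp_treeValue_subtree hNmeas hNlaw hNindep u k hφ.measurable

theorem integral_of_tendsto_treeValue
    (hNmeas : ∀ u, Measurable (N u)) (hNlaw : ∀ u, μ.map (N u) = d) (hNindep : iIndepFun N μ)
    (hm0 : 0 ≤ m) (hm1 : m < 1) (hm : pgf d m = 1 - m) (u : Vertex)
    (hlim : ∀ᵐ ω ∂μ, Tendsto (fun k =>
      treeValue k (fun v => N (u ++ v) ω) fun _ => m) atTop (𝓝 (Y u ω))) :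
    ∫ ω, Y u ω ∂μ = m := by
  refine tendsto_nhds_unique (tendsto_integral_comp_treeValue hNmeas hNlaw hNindep u hlim
    continuous_id) (tendsto_const_nhds.congr fun k => ?_)
  exact (integral_treeValue_const (κ := id) measurable_id Measure.map_id hm0 hm1 hm k).symm

theorem tendsto_momentIter
    (hNmeas : ∀ u, Measurable (N u)) (hNlaw : ∀ u, μ.map (N u) = d) (hNindep : iIndepFun N μ)
    (hm0 : 0 ≤ m) (hm1 : m < 1) (hm : pgf d m = 1 - m) (u : Vertex)
    (hlim : ∀ᵐ ω ∂μ, Tendsto (fun k =>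
      treeValue k (fun v => N (u ++ v) ω) fun _ => m) atTop (𝓝 (Y u ω))) :
    Tendsto (momentIter d m) atTop (𝓝 (∫ ω, Y u ω * Y u ω ∂μ)) := by
  refine (tendsto_integral_comp_treeValue hNmeas hNlaw hNindep u hlim
    (continuous_id.mul continuous_id)).congr fun k => ?_
  exact integral_treeValue_const_sq (κ := id) measurable_id Measure.map_id hm0 hm1 hm k

omit [IsProbabilityMeasure μ] in
theorem ae_eq_treeLimit (u : Vertex) (hlim : ∀ᵐ ω ∂μ, Tendsto (fun k =>
      treeValue k (fun v => N (u ++ v) ω) fun _ => m) atTop (𝓝 (Y u ω))) :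
    (fun ω => treeLimit m fun v => N (u ++ v) ω) =ᵐ[μ] Y u :=
  hlim.mono fun _ h => h.limsup_eq

omit [IsProbabilityMeasure μ] [IsProbabilityMeasure d] in
theorem map_of_tendsto_treeValue (hNmeas : ∀ u, Measurable (N u)) (hNlaw : ∀ u, μ.map (N u) = d)
    (hNindep : iIndepFun N μ) (u : Vertex) (hlim : ∀ᵐ ω ∂μ, Tendsto (fun k =>
      treeValue k (fun v => N (u ++ v) ω) fun _ => m) atTop (𝓝 (Y u ω))) :
    μ.map (Y u) = (Measure.infinitePi fun _ : Vertex => d).map (treeLimit m) := by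
  rw [← map_subtree hNmeas hNlaw hNindep u, Measure.map_map (measurable_treeLimit m)
    (measurable_pi_lambda _ fun v => hNmeas _)]
  exact (Measure.map_congr (ae_eq_treeLimit u hlim)).symm

/-- The limit of the tree values with constant boundary value, when it exists, is a tree
solution. -/
theorem isTreeSolution_of_tendsto_treeValue
    (hNmeas : ∀ u, Measurable (N u)) (hNlaw : ∀ u, μ.map (N u) = d) (hNindep : iIndepFun N μ)
    (hm0 : 0 ≤ m) (hm1 : m < 1) (hm : pgf d m = 1 - m) (hY : ∀ u, Measurable (Y u))
    (hlim : ∀ u, ∀ᵐ ω ∂μ, Tendsto (fun k =>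
      treeValue k (fun v => N (u ++ v) ω) fun _ => m) atTop (𝓝 (Y u ω))) :
    IsTreeSolution μ N Y := by
  have hlevel : ∀ n : ℕ, iIndepFun (fun (u : {u : Vertex // u.length = n}) => Y u.1) μ := by
    intro n
    -- Each Y u is a.s. a function of the sizes in the subtree at u, and subtrees rooted at one
    -- level are disjoint.
    have h := iIndepFun_blocks hNmeas hNindep
      (e := fun (u : {u : Vertex // u.length = n}) (v : Vertex) => u.1 ++ v) (by
        rintro ⟨⟨a, ha⟩, b⟩ ⟨⟨c, hc⟩, e⟩ h
        obtain ⟨h1, h2⟩ := List.append_inj h (ha.trans hc.symm)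
        simp_all)
    exact (h.comp (fun _ => treeLimit m) fun _ => measurable_treeLimit m).congr
      fun u => ae_eq_treeLimit u.1 (hlim u.1)
  refine ⟨hY, fun u => (hlim u).mono fun ω h => mem_Icc_of_tendsto_treeValue h, hlevel,
    fun n => ?_, fun u => ?_, fun u v => ?_⟩
  · have h := indepFun_of_disjoint_ranges hNmeas hNindep
      (fun p : {u : Vertex // u.length = n} × Vertex => p.1.1 ++ p.2)
      (fun v : {v : Vertex // v.length < n} => v.1) (by
        rintro ⟨⟨a, ha⟩, b⟩ ⟨c, hc⟩ h
        have := congrArg List.length h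
        simp only [List.length_append] at this
        omega)
    have hφ : Measurable fun (x : {u : Vertex // u.length = n} × Vertex → ℕ∞)
        (u : {u : Vertex // u.length = n}) => treeLimit m fun v => x (u, v) :=
      measurable_pi_lambda _ fun u => (measurable_treeLimit m).comp
        (measurable_pi_lambda _ fun v => measurable_pi_apply _)
    refine (h.comp hφ measurable_id).congr ?_ (ae_eq_refl _)
    filter_upwards [ae_all_iff.2 fun u => ae_eq_treeLimit u (hlim u)] with ω h
    funext u
    exact h u.1
  -- For an infinite family, continuity of the product needs limit 0. The daughters are independent
  -- with mean m < 1, so this nonnegative product has mean 0 and vanishes a.s.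
  · have htop : ∀ᵐ ω ∂μ, firstProd ⊤ (fun i => unitClamp (Y (u ++ [i]) ω)) = 0 := by
      have hmeas : ∀ i : ℕ, Measurable fun ω => unitClamp (Y (u ++ [i]) ω) :=
        fun i => measurable_unitClamp.comp (hY _)
      have hind : iIndepFun (fun (i : ℕ) ω => unitClamp (Y (u ++ [i]) ω)) μ :=
        ((hlevel (u.length + 1)).precomp (g := fun i : ℕ =>
          (⟨u ++ [i], by simp⟩ : {w : Vertex // w.length = u.length + 1}))
          (fun i j h => by simpa using h)).comp (fun _ => unitClamp) fun _ => measurable_unitClamp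
      have h1 := integral_firstProd hmeas (fun i ω => unitClamp_mem_Icc _) hind ⊤
      have h2 : ∀ i : ℕ, ∫ ω, unitClamp (Y (u ++ [i]) ω) ∂μ = m := by
        intro i
        rw [← integral_of_tendsto_treeValue hNmeas hNlaw hNindep hm0 hm1 hm (u ++ [i]) (hlim _)]
        refine integral_congr_ae ((hlim (u ++ [i])).mono fun ω h => ?_)
        exact unitClamp_of_mem (mem_Icc_of_tendsto_treeValue h)
      simp only [h2, firstProd_top_const hm0 hm1] at h1
      have hmem : ∀ ω, firstProd ⊤ (fun i => unitClamp (Y (u ++ [i]) ω)) ∈ Icc (0 : ℝ) 1 :=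
        fun ω => firstProd_mem_Icc fun i => unitClamp_mem_Icc _
      exact (integral_eq_zero_iff_of_nonneg (fun ω => (hmem ω).1) (integrable_of_mem_Icc
        (measurable_firstProd measurable_const hmeas fun i ω => unitClamp_mem_Icc _) hmem)).1 h1
    filter_upwards [htop, hlim u, ae_all_iff.2 fun i : ℕ => hlim (u ++ [i])] with ω h0 h1 h2
    have hcl : ∀ i, unitClamp (Y (u ++ [i]) ω) = Y (u ++ [i]) ω := fun i =>
      unitClamp_of_mem (mem_Icc_of_tendsto_treeValue (h2 i))
    simp only [hcl] at h0
    -- Depth k + 1 at u corresponds to depth k at its daughters.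
    refine tendsto_nhds_unique ((tendsto_add_atTop_iff_nat 1).2 h1) ?_
    have h3 := tendsto_const_nhds (x := (1 : ℝ)).sub (tendsto_firstProd_of_tendsto (N := N u ω)
      (fun k i => treeValue_mem_Icc _ _ _) h2 fun _ => h0)
    refine h3.congr fun k => ?_
    rw [treeValue_succ]
    simp
  · exact ⟨(hY u).aemeasurable, (hY v).aemeasurable,
      (map_of_tendsto_treeValue hNmeas hNlaw hNindep u (hlim u)).trans
        (map_of_tendsto_treeValue hNmeas hNlaw hNindep v (hlim v)).symm⟩

end LimitSolution

/-! ### From convergence of second moments to equality of laws -/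

theorem tendstoInMeasure_of_tendsto_integral_sq {Ω : Type*} [MeasurableSpace Ω] {μ : Measure Ω}
    {f : ℕ → Ω → ℝ} (hf : ∀ k, MemLp (f k) 2 μ)
    (h : Tendsto (fun k => ∫ ω, f k ω ^ 2 ∂μ) atTop (𝓝 0)) : TendstoInMeasure μ f atTop 0 := by
  refine tendstoInMeasure_of_tendsto_eLpNorm (p := 2) (by simp) (fun k => (hf k).1)
    aestronglyMeasurable_zero ?_
  have h1 : ∀ k, eLpNorm (f k - 0) 2 μ = ENNReal.ofReal ((∫ ω, f k ω ^ 2 ∂μ) ^ (2 : ℝ)⁻¹) := by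
    intro k
    rw [sub_zero, (hf k).eLpNorm_eq_integral_rpow_norm (by simp) (by simp)]
    simp
  simp only [h1]
  have h2 := (h.rpow_const (p := (2 : ℝ)⁻¹) (Or.inr (by norm_num)))
  rw [Real.zero_rpow (by norm_num)] at h2
  simpa using ENNReal.tendsto_ofReal h2

/-- An invariant law whose second moment is the limit of the second moments of the tree values with
constant boundary value is the law of the limit of these tree values. -/
theorem eq_map_treeLimit_of_tendsto_momentIter {d : Measure ℕ∞} [IsProbabilityMeasure d]
    {ν : Measure ℝ} [IsProbabilityMeasure ν] (h01 : ∀ᵐ x ∂ν, x ∈ Icc (0 : ℝ) 1)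
    (hν : rdeMap d ν = ν)
    (hmom : Tendsto (momentIter d (∫ t, t ∂ν)) atTop (𝓝 (∫ t, t * t ∂ν)))
    (hlim : ∀ᵐ z ∂(Measure.infinitePi fun _ : Vertex => d), Tendsto (fun k =>
      treeValue k z fun _ => ∫ t, t ∂ν) atTop (𝓝 (treeLimit (∫ t, t ∂ν) z))) :
    ν = (Measure.infinitePi fun _ : Vertex => d).map (treeLimit (∫ t, t ∂ν)) := by
  set m := ∫ t, t ∂ν with hm
  set P := Measure.infinitePi fun _ : Vertex => d.prod ν
  have hfst : P.map (fun y v => (y v).1) = Measure.infinitePi fun _ : Vertex => d := by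
    have := Measure.infinitePi_map_pi (fun _ : Vertex => d.prod ν) fun _ => measurable_fst
    simpa only [map_fst_prod_prob] using this
  have hfstm : Measurable fun (y : Vertex → ℕ∞ × ℝ) (v : Vertex) => (y v).1 := by fun_prop
  set F : ℕ → (Vertex → ℕ∞ × ℝ) → ℝ := fun k y => treeValue k (fun v => (y v).1) fun _ => m
  set G : ℕ → (Vertex → ℕ∞ × ℝ) → ℝ :=
    fun k y => treeValue k (fun v => (y v).1) fun v => (y v).2
  have hF : ∀ k, Measurable (F k) := fun k => Measurable.treeValue k hfstm measurable_const
  have hG : ∀ k, Measurable (G k) := measurable_treeValue_pair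
  have hZ : Measurable fun y : Vertex → ℕ∞ × ℝ => treeLimit m fun v => (y v).1 :=
    (measurable_treeLimit m).comp hfstm
  have hFlim : TendstoInDistribution F atTop (fun y => treeLimit m fun v => (y v).1)
      (fun _ => P) P := by
    refine tendstoInDistribution_of_ae_tendsto (fun k => (hF k).aemeasurable) hZ.aemeasurable ?_
    rw [← hfst] at hlim
    exact ae_of_ae_map hfstm.aemeasurable hlim
  have hdiff : TendstoInMeasure P (G - F) atTop 0 := by
    refine tendstoInMeasure_of_tendsto_integral_sq (fun k => ?_) ?_
    · refine MemLp.of_bound ((hG k).sub (hF k)).aestronglyMeasurable 1 (ae_of_all _ fun y => ?_)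
      have h1 := treeValue_mem_Icc k (fun v => (y v).1) fun v => (y v).2
      have h2 := treeValue_mem_Icc k (fun v => (y v).1) fun _ => m
      rw [Real.norm_eq_abs, abs_le]
      constructor
      · simp only [Pi.sub_apply, G, F]
        linarith [h1.1, h2.2]
      · simp only [Pi.sub_apply, G, F]
        linarith [h1.2, h2.1]
    · have h3 := hmom.const_sub (∫ t, t * t ∂ν)
      rw [sub_self] at h3
      exact h3.congr fun k => (integral_treeValue_sub_sq h01 hν k).symm
  -- Slutsky: G differs from the convergent F by a term tending to 0 in measure. But every G k has
  -- law ν, so ν must be the limiting law.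
  have hGlim := tendstoInDistribution_of_tendstoInMeasure_sub G _ hFlim hdiff
    fun k => (hG k).aemeasurable
  have hid : ∀ k, IdentDistrib (G 0) (G k) P P := fun k => ⟨(hG 0).aemeasurable, (hG k).aemeasurable,
    (map_treeValue_of_invariant h01 hν 0).trans (map_treeValue_of_invariant h01 hν k).symm⟩
  have hGconst : TendstoInDistribution G atTop (G 0) (fun _ => P) P :=
    tendstoInDistribution_of_identDistrib 0 hid (hid 0)
  have h := tendstoInDistribution_unique G hGconst hGlim
  rw [← hfst, Measure.map_map (measurable_treeLimit m) hfstm]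
  exact (map_treeValue_of_invariant h01 hν 0).symm.trans h

/-! ### Convexity and fixed points of the generating function -/

section Pgf

variable (d : Measure ℕ∞) [IsProbabilityMeasure d]

theorem summable_measureReal_natCast : Summable fun n : ℕ => d.real {(n : ℕ∞)} := by
  have h := (summable_measure_toReal (μ := d) (f := fun n : ℕ => ({(n : ℕ∞)} : Set ℕ∞))
    (fun _ => MeasurableSet.of_discrete) (fun i j hij => by simpa using hij))
  exact h

theorem summable_pgf {s : ℝ} (hs : s ∈ Icc (0 : ℝ) 1) :
    Summable fun n : ℕ => d.real {(n : ℕ∞)} * s ^ n :=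
  (summable_measureReal_natCast d).of_nonneg_of_le
    (fun _ => mul_nonneg measureReal_nonneg (pow_nonneg hs.1 _))
    fun _ => mul_le_of_le_one_right measureReal_nonneg (pow_le_one₀ hs.1 hs.2)

theorem pgf_mono {s t : ℝ} (hs : 0 ≤ s) (hst : s ≤ t) (ht : t ≤ 1) : pgf d s ≤ pgf d t :=
  (summable_pgf d ⟨hs, hst.trans ht⟩).tsum_le_tsum
    (fun n => mul_le_mul_of_nonneg_left (pow_le_pow_left₀ hs hst n) measureReal_nonneg)
    (summable_pgf d ⟨hs.trans hst, ht⟩)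

/-- Termwise differentiation on a ball of radius R with s < R < 1, majorised by the summable n
R^(n−1). -/
theorem differentiableAt_pgf {s : ℝ} (hs : s ∈ Ico (0 : ℝ) 1) : DifferentiableAt ℝ (pgf d) s := by
  obtain ⟨R, hsR, hR⟩ := exists_between hs.2
  have hR0 : 0 ≤ R := hs.1.trans hsR.le
  have hu : Summable fun n : ℕ => (n : ℝ) * R ^ (n - 1) := by
    have h := summable_pow_mul_geometric_of_norm_lt_one 1 (r := R)
      (by rwa [Real.norm_of_nonneg hR0])
    rcases hR0.eq_or_lt with rfl | hpos
    · exact absurd hsR (not_lt.2 hs.1)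
    refine (h.mul_left R⁻¹).congr fun n => ?_
    rcases n with _ | n
    · simp
    · simp only [Nat.add_sub_cancel, pow_succ]
      field_simp
  have hder := hasDerivAt_tsum_of_isPreconnected (𝕜 := ℝ) (t := Metric.ball (0 : ℝ) R)
    (g := fun (n : ℕ) y => d.real {(n : ℕ∞)} * y ^ n)
    (g' := fun n y => d.real {(n : ℕ∞)} * (n * y ^ (n - 1))) hu Metric.isOpen_ball
    (convex_ball (0 : ℝ) R).isPreconnected
    (fun n y _ => (hasDerivAt_pow n y).const_mul _) (fun n y hy => ?_)
    (y₀ := s) (by simpa [abs_of_nonneg hs.1] using hsR) (summable_pgf d ⟨hs.1, hs.2.le⟩)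
    (y := s) (by simpa [abs_of_nonneg hs.1] using hsR)
  · exact hder.differentiableAt
  · have hy' : |y| ≤ R := by simpa using (mem_ball_zero_iff.1 hy).le
    rw [norm_mul, norm_mul, norm_pow, Real.norm_of_nonneg measureReal_nonneg,
      Real.norm_of_nonneg (Nat.cast_nonneg n), Real.norm_eq_abs]
    refine (mul_le_of_le_one_left (by positivity) measureReal_le_one).trans ?_
    gcongr

variable {d}

/-- A nondecreasing function meets the strictly decreasing 1 − s at most once. -/
theorem root_unique {a b : ℝ} (ha0 : 0 ≤ a) (ha1 : a < 1) (hb0 : 0 ≤ b) (hb1 : b < 1)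
    (ha : pgf d a = 1 - a) (hb : pgf d b = 1 - b) : a = b := by
  rcases lt_trichotomy a b with h | h | h
  · have := pgf_mono d ha0 h.le hb1.le
    linarith
  · exact h
  · have := pgf_mono d hb0 h.le ha1.le
    linarith

omit [IsProbabilityMeasure d] in
-- Three distinct fixed points would give two adjacent chords of slope 1, against strict convexity.
theorem eq_or_eq_of_le_of_pgf_eq (hconv : StrictConvexOn ℝ (Icc (0 : ℝ) 1) (pgf d))
    {a b c q : ℝ} (ha0 : 0 ≤ a) (hab : a ≤ b) (hbc : b ≤ c) (hc1 : c ≤ 1)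
    (ha : a = q + pgf d a) (hb : b = q + pgf d b) (hc : c = q + pgf d c) : b = a ∨ b = c := by
  by_contra! h
  have h1 : a < b := lt_of_le_of_ne hab h.1.symm
  have h2 : b < c := lt_of_le_of_ne hbc h.2
  have := hconv.slope_strict_mono_adjacent ⟨ha0, by linarith⟩ ⟨by linarith, hc1⟩ h1 h2
  rw [show pgf d b - pgf d a = b - a by linarith, show pgf d c - pgf d b = c - b by linarith,
    div_self (by linarith), div_self (by linarith)] at this
  exact lt_irrefl _ this

/-- Two distinct fixed points span a chord of slope 1, which strict convexity puts strictly below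
the derivative at its right end. -/
theorem eq_of_deriv_pgf_le_one (hconv : StrictConvexOn ℝ (Icc (0 : ℝ) 1) (pgf d))
    {a c q : ℝ} (ha0 : 0 ≤ a) (hac : a ≤ c) (hc1 : c < 1)
    (ha : a = q + pgf d a) (hc : c = q + pgf d c) (hder : deriv (pgf d) c ≤ 1) : a = c := by
  by_contra h
  have h1 : a < c := lt_of_le_of_ne hac h
  have := hconv.slope_lt_deriv ⟨ha0, by linarith⟩ ⟨by linarith, hc1.le⟩ h1
    (differentiableAt_pgf d ⟨by linarith, hc1⟩)
  rw [slope_def_field, show pgf d c - pgf d a = c - a by linarith, div_self (by linarith)] at this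
  linarith

omit [IsProbabilityMeasure d] in
theorem exists_pgf_lt_of_one_lt_deriv {c q b : ℝ} (hbc : b < c)
    (hc : c = q + pgf d c) (hder : 1 < deriv (pgf d) c) :
    ∃ r ∈ Ioo b c, q + pgf d r < r := by
  have hd : HasDerivAt (pgf d) (deriv (pgf d) c) c :=
    -- `deriv` is 0 where the derivative does not exist, so a value above 1 already gives
    -- differentiability.
    (differentiableAt_of_deriv_ne_zero (by linarith)).hasDerivAt
  have h1 := (hasDerivAt_iff_tendsto_slope.1 hd).mono_left
    (nhdsWithin_mono c (t := {c}ᶜ) (s := Iio c) fun x hx => ne_of_lt hx)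
  obtain ⟨r, hr, hr'⟩ := ((h1.eventually (lt_mem_nhds hder)).and
    (Ioo_mem_nhdsLT hbc)).exists
  refine ⟨r, hr', ?_⟩
  rw [slope_def_field, ← neg_div_neg_eq, lt_div_iff₀ (by linarith [hr'.2])] at hr
  linarith

theorem momentIter_nonneg {m : ℝ} (hm0 : 0 ≤ m) (hm1 : m < 1) (hm : pgf d m = 1 - m) (k : ℕ) :
    0 ≤ momentIter d m k := by
  rw [← integral_treeValue_const_sq (ρ := d) (κ := id) measurable_id Measure.map_id hm0 hm1 hm k]
  exact integral_nonneg fun y => mul_self_nonneg _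

/-- A point that Q does not raise is a barrier: by monotonicity, iterates starting below it remain
below. -/
theorem momentIter_le {m r : ℝ} (hm0 : 0 ≤ m) (hm1 : m < 1) (hm : pgf d m = 1 - m)
    (hmr : m * m ≤ r) (hr1 : r ≤ 1) (hr : 2 * m - 1 + pgf d r ≤ r) (k : ℕ) :
    momentIter d m k ≤ r := by
  induction k with
  | zero => exact hmr
  | succ k ih =>
    rw [momentIter]
    linarith [pgf_mono d (momentIter_nonneg hm0 hm1 hm k) ih hr1]

end Pgf

/-! ### Laws on {0,1} -/

/-- Two probability measures on `{0, 1}` with the same mean agree. -/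
theorem eq_of_ae_zero_or_one {ν ν' : Measure ℝ} [IsProbabilityMeasure ν] [IsProbabilityMeasure ν']
    (h : ∀ᵐ t ∂ν, t = 0 ∨ t = 1) (h' : ∀ᵐ t ∂ν', t = 0 ∨ t = 1)
    (hmean : ∫ t, t ∂ν = ∫ t, t ∂ν') : ν = ν' := by
  have key : ∀ (ρ : Measure ℝ) [IsProbabilityMeasure ρ], (∀ᵐ t ∂ρ, t = 0 ∨ t = 1) →
      ∀ f : BoundedContinuousFunction ℝ ℝ,
        ∫ t, f t ∂ρ = f 0 + (f 1 - f 0) * ∫ t, t ∂ρ := by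
    intro ρ _ hρ f
    have hint : Integrable (fun t : ℝ => t) ρ :=
      Integrable.of_bound (by fun_prop) 1 (hρ.mono fun t ht => by rcases ht with rfl | rfl <;> simp)
    calc ∫ t, f t ∂ρ = ∫ t, (f 0 + (f 1 - f 0) * t) ∂ρ :=
          integral_congr_ae (hρ.mono fun t ht => by rcases ht with rfl | rfl <;> simp)
      _ = _ := by
          rw [integral_add (integrable_const _) (hint.const_mul _), integral_const_mul]
          simp
  refine ext_of_forall_integral_eq_of_IsFiniteMeasure fun f => ?_
  rw [key ν h f, key ν' h' f, hmean]

/-- A probability measure on `[0,1]` whose second moment equals its mean sits on `{0, 1}`. -/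
theorem ae_zero_or_one_of_integral_mul_self {ν : Measure ℝ} [IsProbabilityMeasure ν]
    (h01 : ∀ᵐ x ∂ν, x ∈ Icc (0 : ℝ) 1) (h : ∫ t, t * t ∂ν = ∫ t, t ∂ν) :
    ∀ᵐ t ∂ν, t = 0 ∨ t = 1 := by
  have i1 : Integrable (fun t : ℝ => t) ν :=
    Integrable.of_bound (by fun_prop) 1 (h01.mono fun t ht => by
      rw [Real.norm_of_nonneg ht.1]
      exact ht.2)
  have i2 : Integrable (fun t : ℝ => t * t) ν :=
    Integrable.of_bound (by fun_prop) 1 (h01.mono fun t ht => by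
      have := mul_mem_Icc ht ht
      rw [Real.norm_of_nonneg this.1]
      exact this.2)
  have hz := (integral_eq_zero_iff_of_nonneg_ae (μ := ν) (f := fun t => t - t * t)
    (h01.mono fun t ht => sub_nonneg.2 (mul_le_of_le_one_right ht.1 ht.2)) (i1.sub i2)).1
    (by rw [integral_sub i1 i2, h, sub_self])
  filter_upwards [hz] with t ht
  have : t * (1 - t) = 0 := by
    have : t - t * t = 0 := ht
    linarith
  rcases mul_eq_zero.1 this with h | h
  · exact Or.inl h
  · exact Or.inr (by linarith)

/-! ### The conditional probability process as a projection -/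

section CondProb

variable {Ω : Type*} [MeasurableSpace Ω] {μ : Measure Ω} [IsProbabilityMeasure μ]
  {d : Measure ℕ∞} [IsProbabilityMeasure d] {N : Vertex → Ω → ℕ∞} {S : Vertex → Ω → ℝ}

omit [IsProbabilityMeasure μ] in
theorem familySigma_le (hNmeas : ∀ u, Measurable (N u)) : familySigma N ≤ ‹MeasurableSpace Ω› :=
  iSup_le fun v => (hNmeas v).comap_le

omit [IsProbabilityMeasure μ] in
theorem condProbSolution_ae_eq (hS : IsDiscreteSolution μ N S) (u : Vertex) :
    condProbSolution μ N S u =ᵐ[μ] μ[S u | familySigma N] := by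
  refine condExp_congr_ae ?_
  filter_upwards [hS.zero_or_one u] with ω h
  rcases h with h | h <;> simp [Set.indicator, h]

/-- C u is the L² projection of S u onto the family σ-algebra, so pulling it out of the conditional
expectation gives E[SC] = E[C²]. -/
theorem integral_mul_condProbSolution (hNmeas : ∀ u, Measurable (N u))
    (hS : IsDiscreteSolution μ N S) (u : Vertex)
    (hC01 : ∀ᵐ ω ∂μ, condProbSolution μ N S u ω ∈ Icc (0 : ℝ) 1) (hSint : Integrable (S u) μ) :
    ∫ ω, S u ω * condProbSolution μ N S u ω ∂μ =
      ∫ ω, condProbSolution μ N S u ω * condProbSolution μ N S u ω ∂μ := by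
  have hle := familySigma_le hNmeas
  have hCm : StronglyMeasurable[familySigma N] (condProbSolution μ N S u) :=
    stronglyMeasurable_condExp
  have hint : Integrable (S u * condProbSolution μ N S u) μ := by
    refine hSint.mul_bdd (c := 1) (hCm.mono hle).aestronglyMeasurable (hC01.mono fun ω h => ?_)
    rw [Real.norm_of_nonneg h.1]
    exact h.2
  have h1 := condExp_mul_of_stronglyMeasurable_right hCm hint hSint
  calc _ = ∫ ω, (μ[S u * condProbSolution μ N S u | familySigma N]) ω ∂μ :=
        (integral_condExp hle).symm
    _ = _ := by
        refine integral_congr_ae ?_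
        filter_upwards [h1, condProbSolution_ae_eq hS u] with ω h2 h3
        rw [h2, Pi.mul_apply, ← h3]

end CondProb

/-! ### Endogeny, uniqueness and classification of invariant laws -/

theorem theorem4p2 {Ω : Type*} [MeasurableSpace Ω] (μ : Measure Ω) [IsProbabilityMeasure μ]
    (d : Measure ℕ∞) [IsProbabilityMeasure d]
    (hH0 : pgf d 0 = 0) (hHconv : StrictConvexOn ℝ (Icc (0 : ℝ) 1) (pgf d))
    (N : Vertex → Ω → ℕ∞) (hNmeas : ∀ u, Measurable (N u))
    (hNlaw : ∀ u, μ.map (N u) = d) (hNindep : iIndepFun N μ)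
    (S : Vertex → Ω → ℝ) (hS : IsDiscreteSolution μ N S) :
    (IsEndogenous μ N S ↔ deriv (pgf d) (∫ ω, S [] ω ∂μ) ≤ 1) ∧
    (IsTreeSolution μ N (condProbSolution μ N S) ∧
      IsEndogenous μ N (condProbSolution μ N S) ∧
      ∀ L : Vertex → Ω → ℝ, IsTreeSolution μ N L → IsEndogenous μ N L →
        ∀ u, L u =ᵐ[μ] condProbSolution μ N S u) ∧
    (∀ ν : Measure ℝ, IsInvariantLaw d ν ↔
      ν = μ.map (S []) ∨ ν = μ.map (condProbSolution μ N S [])) := by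
  have hle := familySigma_le hNmeas
  have hST := hS.toIsTreeSolution
  have hmap : ∀ {X : Vertex → Ω → ℝ}, IsTreeSolution μ N X → ∀ u, ∀ φ : ℝ → ℝ, Measurable φ →
      ∫ t, φ t ∂(μ.map (X u)) = ∫ ω, φ (X u ω) ∂μ := fun hX u φ hφ =>
    integral_map (hX.measurable u).aemeasurable hφ.aestronglyMeasurable
  have hsqm : Measurable fun t : ℝ => t * t := by fun_prop
  have hSinv := hST.isInvariantLaw hNmeas hNlaw
  obtain ⟨hSp, hS01, hSeq⟩ := id hSinv
  obtain ⟨hm0, hm1, hm⟩ := mean_of_invariant hS01 hSeq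
  have hmS : ∀ u, ∫ ω, S u ω ∂μ = ∫ t, t ∂(μ.map (S [])) := fun u => by
    rw [hST.map_eq [] u]
    exact (hmap hST u _ measurable_id).symm
  rw [hmS]
  set m := ∫ t, t ∂(μ.map (S [])) with hmdef
  set C := condProbSolution μ N S with hCdef
  have hCS : ∀ u, C u =ᵐ[μ] μ[S u | familySigma N] := condProbSolution_ae_eq hS
  have hCm : ∀ u, Measurable[familySigma N] (C u) := fun u => stronglyMeasurable_condExp.measurable
  have hClim : ∀ u, ∀ᵐ ω ∂μ, Tendsto (fun k =>
      treeValue k (fun v => N (u ++ v) ω) fun _ => m) atTop (𝓝 (C u ω)) := fun u => by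
    filter_upwards [hST.ae_tendsto_condExp hNmeas u, hCS u] with ω h1 h2
    rwa [h2]
  have hCT : IsTreeSolution μ N C := isTreeSolution_of_tendsto_treeValue hNmeas hNlaw hNindep
    hm0 hm1 hm (fun u => (hCm u).mono hle le_rfl) hClim
  have hmean : ∀ ν : Measure ℝ, IsInvariantLaw d ν → ∫ t, t ∂ν = m := by
    rintro ν ⟨hp, h01, hν⟩
    obtain ⟨h0, h1, h2⟩ := mean_of_invariant h01 hν
    exact root_unique h0 h1 hm0 hm1 h2 hm
  have huniq : ∀ L : Vertex → Ω → ℝ, IsTreeSolution μ N L → IsEndogenous μ N L →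
      ∀ u, L u =ᵐ[μ] C u := by
    intro L hL hLe u
    obtain ⟨Y, hY, hLY⟩ := hLe u
    have hLint : Integrable (L u) μ :=
      Integrable.of_bound (hL.measurable u).aestronglyMeasurable 1 ((hL.mem_Icc u).mono fun ω h => by
        rw [Real.norm_of_nonneg h.1]
        exact h.2)
    have h1 : μ[L u | familySigma N] =ᵐ[μ] L u := condExp_of_aestronglyMeasurable' hle
      ⟨Y, hY.stronglyMeasurable, hLY⟩ hLint
    have h2 := hL.condExp_ae_eq_treeLimit hNmeas u
    rw [hmean _ (hL.isInvariantLaw hNmeas hNlaw)] at h2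
    exact (h1.symm.trans h2).trans (ae_eq_treeLimit u (hClim u))
  have hCinv := hCT.isInvariantLaw hNmeas hNlaw
  have hmom : ∀ u, Tendsto (momentIter d m) atTop (𝓝 (∫ ω, C u ω * C u ω ∂μ)) := fun u =>
    tendsto_momentIter hNmeas hNlaw hNindep hm0 hm1 hm u (hClim u)
  set r := ∫ ω, C [] ω * C [] ω ∂μ with hr
  have hroot : ∀ ν : Measure ℝ, IsInvariantLaw d ν →
      ∫ t, t * t ∂ν = 2 * m - 1 + pgf d (∫ t, t * t ∂ν) := by
    intro ν hνi
    have hνm := hmean ν hνi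
    obtain ⟨hp, h01, hν⟩ := hνi
    rw [← hνm]
    exact integral_mul_self_of_invariant h01 hν
  have hrC : r = ∫ t, t * t ∂(μ.map (C [])) := (hmap hCT [] _ hsqm).symm
  have hrroot : r = 2 * m - 1 + pgf d r := by
    rw [hrC]
    exact hroot _ hCinv
  have hmroot : m = 2 * m - 1 + pgf d m := by
    rw [hm]
    ring
  have hr0 : 0 ≤ r := integral_nonneg fun ω => mul_self_nonneg _
  have hle_m : ∀ ν : Measure ℝ, IsInvariantLaw d ν → ∫ t, t * t ∂ν ≤ m := by
    intro ν hνi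
    rw [← hmean ν hνi]
    obtain ⟨hp, h01, hν⟩ := hνi
    refine integral_mono_of_nonneg (ae_of_all _ fun t => mul_self_nonneg t) ?_
      (h01.mono fun t ht => mul_le_of_le_one_right ht.1 ht.2)
    exact Integrable.of_bound (by fun_prop) 1 (h01.mono fun t ht => by
      rw [Real.norm_of_nonneg ht.1]
      exact ht.2)
  have hr_le : ∀ ν : Measure ℝ, IsInvariantLaw d ν → r ≤ ∫ t, t * t ∂ν := by
    intro ν hνi
    have hνm := hmean ν hνi
    obtain ⟨hp, h01, hν⟩ := hνi
    -- A squared distance is nonnegative, so each iterate is at most the second moment of ν, and so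
    -- is their limit r.
    refine le_of_tendsto' (hmom []) fun k => ?_
    have h1 := integral_treeValue_sub_sq h01 hν k
    rw [hνm] at h1
    exact sub_nonneg.1 (h1 ▸ integral_nonneg fun y => sq_nonneg _)
  have hSsq : ∀ u, ∫ ω, S u ω * S u ω ∂μ = m := fun u => by
    rw [← hmS u]
    exact integral_congr_ae ((hS.zero_or_one u).mono fun ω h => by
      rcases h with h | h <;> simp [h])
  refine ⟨⟨fun hend => ?_, fun hder u => ?_⟩, ⟨hCT, fun u => ⟨C u, hCm u, ae_eq_refl _⟩, huniq⟩,
    fun ν => ⟨fun hν => ?_, ?_⟩⟩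
  · by_contra! hder
    have hrm : r = m := by
      rw [hr, ← hSsq []]
      refine integral_congr_ae ((huniq S hST hend []).mono fun ω h => ?_)
      simp only [h]
    -- If m = 0 then H(0) = 1, against H(0) = 0. With m < 1 this gives m² < m, leaving room for a
    -- barrier between the start of the iteration and m.
    have hmpos : 0 < m := lt_of_le_of_ne hm0 fun h => by
      rw [← h, hH0] at hm
      norm_num at hm
    obtain ⟨q, hq, hqlt⟩ := exists_pgf_lt_of_one_lt_deriv (b := m * m) (by nlinarith) hmroot hder
    have : r ≤ q := le_of_tendsto' (hmom []) fun k =>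
      momentIter_le hm0 hm1 hm hq.1.le (hq.2.le.trans hm1.le) hqlt.le k
    linarith [hq.2]
  · have hrm : r = m := eq_of_deriv_pgf_le_one hHconv hr0 (hrC ▸ hle_m _ hCinv) hm1 hrroot
      hmroot hder
    have hCsq : ∫ ω, C u ω * C u ω ∂μ = m := (tendsto_nhds_unique (hmom u) (hmom [])).trans hrm
    have hb : ∀ {X : Vertex → Ω → ℝ}, IsTreeSolution μ N X → MemLp (X u) 2 μ := fun hX =>
      MemLp.of_bound (hX.measurable u).aestronglyMeasurable 1 ((hX.mem_Icc u).mono fun ω h => by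
        rw [Real.norm_of_nonneg h.1]
        exact h.2)
    have hSC := integral_mul_condProbSolution hNmeas hS u (hCT.mem_Icc u)
      ((hb hST).integrable one_le_two)
    rw [← hCdef, hCsq] at hSC
    have iSS : Integrable (fun ω => S u ω * S u ω) μ := (hb hST).integrable_mul (hb hST)
    have iSC : Integrable (fun ω => S u ω * C u ω) μ := (hb hST).integrable_mul (hb hCT)
    have iCC : Integrable (fun ω => C u ω * C u ω) μ := (hb hCT).integrable_mul (hb hCT)
    -- E[S²] = m since S is {0,1}-valued, and E[SC] = E[C²] = r = m, so the total is m − 2m + m.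
    have h0 : ∫ ω, (S u ω - C u ω) ^ 2 ∂μ = 0 := by
      calc _ = ∫ ω, (S u ω * S u ω - 2 * (S u ω * C u ω) + C u ω * C u ω) ∂μ := by
            congr 1
            funext ω
            ring
        _ = _ := by
            have s1 := integral_sub iSS (iSC.const_mul 2)
            have s2 := integral_add (iSS.sub (iSC.const_mul 2)) iCC
            simp only [Pi.sub_apply] at s2
            rw [s2, s1, integral_const_mul, hSC, hCsq, hSsq]
            ring
    have h1 := (integral_eq_zero_iff_of_nonneg (fun ω => sq_nonneg _)
      ((hb hST).sub (hb hCT)).integrable_sq).1 h0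
    refine ⟨C u, hCm u, ?_⟩
    filter_upwards [h1] with ω h
    exact sub_eq_zero.1 (pow_eq_zero_iff (two_ne_zero) |>.1 h)
  · have hνm := hmean ν hν
    rcases eq_or_eq_of_le_of_pgf_eq hHconv hr0 (hr_le ν hν) (hle_m ν hν) hm1.le hrroot
      (hroot ν hν) hmroot with h | h
    · right
      obtain ⟨hp, h01, hνeq⟩ := hν
      rw [map_of_tendsto_treeValue hNmeas hNlaw hNindep [] (hClim []), ← hνm]
      refine eq_map_treeLimit_of_tendsto_momentIter h01 hνeq ?_ ?_
      · rw [hνm, h]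
        exact hmom []
      -- Convergence is known on Ω; it transfers to the product measure, which is the law of the
      -- size field at the root.
      · rw [hνm, ← map_subtree hNmeas hNlaw hNindep [], ae_map_iff]
        · filter_upwards [hClim [], ae_eq_treeLimit [] (hClim [])] with ω h1 h2
          rwa [h2]
        · exact (measurable_pi_lambda _ fun v => hNmeas _).aemeasurable
        · exact measurableSet_tendsto_fun
            (fun k => Measurable.treeValue k measurable_id measurable_const)
            (measurable_treeLimit m)
    · left
      obtain ⟨hp, h01, -⟩ := hν
      exact eq_of_ae_zero_or_one (ae_zero_or_one_of_integral_mul_self h01 (h.trans hνm.symm))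
        ((ae_map_iff (hST.measurable []).aemeasurable ((measurableSet_singleton 0).union (measurableSet_singleton 1))).2 (hS.zero_or_one []))
        hνm
  · rintro (rfl | rfl)
    · exact hSinv
    · exact hCinv
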